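/- Write $\widehat f(\xi)=(2\pi)^{-n/2}\int_{\mathbb R^n}e^{-ix\cdot\xi}f(x)\,dx$ for the Fourier transform, extended by duality to the tempered distributions $\mathcal S'(\mathbb R^n)$. For $z\in\mathbb C$ with $\operatorname{Re}z\ge0$ let $e^{z\Delta}$ be the operator on $\mathcal S'(\mathbb R^n)$ given by $\widehat{e^{z\Delta}u}=e^{-z|\xi|^2}\,\widehat u$ (so $e^{it\Delta}$, $t\in\mathbb R$, is the free Schrödinger group and $e^{\delta\Delta}$, $\delta>0$, the heat semigroup). For $a>0$, $u\in L^2(e^{a|x|^2}dx)$ means that the distribution $u$ is given by a function with $\int_{\mathbb R^n}|u(x)|^2e^{a|x|^2}dx<\infty$. Theorem 1.1. Let $u_0\in\mathcal S'(\mathbb R^n)$ and let $\tau\in\mathbb R$ be arbitrary. The following seven statements are equivalent: (i) There are two different real numbers $t_1,t_2$ and numbers $a_1,a_2>0$ such that $e^{it_j\Delta}u_0\in L^2(e^{a_j|x|^2}dx)$ for $j=1,2$. (ii) There are $b_1,b_2>0$ such that $u_0\in L^2(e^{b_1|x|^2}dx)$ and $\widehat{u_0}\in L^2(e^{b_2|x|^2}dx)$.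 (iii) There is a function $\nu:[0,+\infty)\to(0,+\infty)$ such that $e^{it\Delta}u_0\in L^2(e^{\nu(t)|x|^2}dx)$ for all $t\ge0$. (iv) The distribution $g(x)=e^{i\tau|x|^2}u_0(x)$ satisfies (ii), with possibly different constants $b_1,b_2>0$. (v) $u_0$ is the restriction to $\mathbb R^n$ of an entire function on $\mathbb C^n$, again denoted $u_0$, such that $|u_0(x+iy)|\le Ne^{-a|x|^2+b|y|^2}$ for all $x,y\in\mathbb R^n$ and some constants $N,a,b>0$. (vi) $\widehat{u_0}$ satisfies (v), with possibly different constants $N,a,b>0$. (vii) There are $\delta,\epsilon>0$ and $h\in L^2(e^{\epsilon|x|^2}dx)$ such that $u_0=e^{\delta\Delta}h$. -/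

import Mathlib

open MeasureTheory
open scoped SchwartzMap FourierTransform NNReal ContDiff

noncomputable section

namespace GaussianDecay

/-- The function `x ↦ exp (c |x|²)` on `ℝⁿ`, where `c` is a complex number. -/
def gaussian {n : ℕ} (c : ℂ) (x : EuclideanSpace ℝ (Fin n)) : ℂ :=
  Complex.exp (c * ((‖x‖ ^ 2 : ℝ) : ℂ))

/-- For `Re c ≤ 0` the function `exp (c |x|²)` is smooth with polynomially bounded derivatives, so
that multiplying a tempered distribution by it makes sense. -/
theorem hasTemperateGrowth_gaussian {n : ℕ} {c : ℂ} (hc : c.re ≤ 0) :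
    (gaussian c : EuclideanSpace ℝ (Fin n) → ℂ).HasTemperateGrowth := by
  have hsm : ContDiff ℝ ∞ (fun s : ℝ ↦ Complex.exp (c * (s : ℂ))) := by
    have : ContDiff ℝ ∞ (fun s : ℝ ↦ (s : ℂ)) := Complex.ofRealCLM.contDiff
    fun_prop
  have hder : ∀ k : ℕ, iteratedDeriv k (fun s : ℝ ↦ Complex.exp (c * (s : ℂ))) =
      fun s : ℝ ↦ c ^ k * Complex.exp (c * (s : ℂ)) := by
    intro k
    induction k with
    | zero => simp
    | succ k ih =>
      rw [iteratedDeriv_succ, ih]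
      ext s
      have h1 : HasDerivAt (fun s : ℝ ↦ c * (s : ℂ)) c s := by
        simpa using (Complex.ofRealCLM.hasDerivAt (x := s)).const_mul c
      rw [((h1.cexp).const_mul (c ^ k)).deriv]
      ring
  refine Function.HasTemperateGrowth.comp' (D := EuclideanSpace ℝ (Fin n))
    (g := fun s : ℝ ↦ Complex.exp (c * (s : ℂ))) (f := fun x ↦ ‖x‖ ^ 2) (t := Set.Ici (0 : ℝ))
    ?_ (uniqueDiffOn_Ici 0) hsm.contDiffOn ?_ (Function.hasTemperateGrowth_norm_sq _)
  · rintro _ ⟨x, rfl⟩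
    exact sq_nonneg ‖x‖
  · intro N
    refine ⟨0, ∑ k ∈ Finset.range (N + 1), ‖c‖ ^ k, by positivity, fun k hk s hs ↦ ?_⟩
    rw [iteratedFDerivWithin_eq_iteratedFDeriv (uniqueDiffOn_Ici 0)
      (hsm.contDiffAt.of_le (mod_cast le_top)) hs, norm_iteratedFDeriv_eq_norm_iteratedDeriv, hder]
    have h2 : ‖Complex.exp (c * (s : ℂ))‖ ≤ 1 := by
      rw [Complex.norm_exp]
      apply Real.exp_le_one_iff.2
      simpa using mul_nonpos_of_nonpos_of_nonneg hc hs
    have h3 : ‖c‖ ^ k ≤ ∑ k ∈ Finset.range (N + 1), ‖c‖ ^ k :=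
      Finset.single_le_sum (f := fun k ↦ ‖c‖ ^ k) (fun i _ ↦ by positivity)
        (Finset.mem_range.2 (by omega))
    rw [norm_mul, norm_pow, pow_zero, mul_one]
    calc ‖c‖ ^ k * ‖Complex.exp (c * (s : ℂ))‖ ≤ ‖c‖ ^ k * 1 := by gcongr
      _ ≤ _ := by rw [mul_one]; exact h3

/-- The dilation `x ↦ (2π)⁻¹ x` of `ℝⁿ`. -/
def dilation (n : ℕ) : EuclideanSpace ℝ (Fin n) ≃L[ℝ] EuclideanSpace ℝ (Fin n) :=
  ContinuousLinearEquiv.smulLeft (Units.mk0 ((2 * Real.pi)⁻¹ : ℝ) (by positivity))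

/-- The Fourier transform of Schwartz functions in the normalization
`φ ↦ (2π)^(-n/2) ∫ exp (-i x·ξ) φ(x) dx`, see `schwartzFourier_apply`. -/
def schwartzFourier (n : ℕ) :
    𝓢(EuclideanSpace ℝ (Fin n), ℂ) →L[ℂ] 𝓢(EuclideanSpace ℝ (Fin n), ℂ) :=
  (((2 * Real.pi) ^ (-(n : ℝ) / 2) : ℝ) : ℂ) •
    (SchwartzMap.compCLMOfContinuousLinearEquiv ℂ (dilation n) ∘L
      FourierTransform.fourierCLM ℂ 𝓢(EuclideanSpace ℝ (Fin n), ℂ))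

theorem schwartzFourier_apply {n : ℕ} (φ : 𝓢(EuclideanSpace ℝ (Fin n), ℂ))
    (ξ : EuclideanSpace ℝ (Fin n)) :
    schwartzFourier n φ ξ = (((2 * Real.pi) ^ (-(n : ℝ) / 2) : ℝ) : ℂ) *
      ∫ x, Complex.exp (-Complex.I * ((inner ℝ x ξ : ℝ) : ℂ)) * φ x := by
  have h : schwartzFourier n φ ξ = (((2 * Real.pi) ^ (-(n : ℝ) / 2) : ℝ) : ℂ) *
    (𝓕 φ) ((2 * Real.pi)⁻¹ • ξ) := rfl
  rw [h, SchwartzMap.fourier_coe, Real.fourier_eq']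
  congr 1
  refine integral_congr_ae (Filter.Eventually.of_forall fun x ↦ ?_)
  simp only [inner_smul_right, smul_eq_mul]
  congr 2
  have := Real.pi_ne_zero
  push_cast
  field_simp

/-- The Fourier transform `û` of a tempered distribution `u`, in the normalization
`û(ξ) = (2π)^(-n/2) ∫ exp (-i x·ξ) u(x) dx`, defined by duality: `û(φ) = u(φ̂)`. -/
def fourier {n : ℕ} (u : TemperedDistribution (EuclideanSpace ℝ (Fin n)) ℂ) :
    TemperedDistribution (EuclideanSpace ℝ (Fin n)) ℂ :=
  PointwiseConvergenceCLM.precomp ℂ (schwartzFourier n) u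

theorem fourier_apply {n : ℕ} (u : TemperedDistribution (EuclideanSpace ℝ (Fin n)) ℂ)
    (φ : 𝓢(EuclideanSpace ℝ (Fin n), ℂ)) : fourier u φ = u (schwartzFourier n φ) := rfl

/-- The product `exp (c |x|²) u` for a tempered distribution `u`, used for `Re c ≤ 0`. -/
def mulGaussian {n : ℕ} (c : ℂ) (u : TemperedDistribution (EuclideanSpace ℝ (Fin n)) ℂ) :
    TemperedDistribution (EuclideanSpace ℝ (Fin n)) ℂ :=
  TemperedDistribution.smulLeftCLM ℂ (gaussian c) u

/-- The operator `exp (z Δ)` on tempered distributions, used for `Re z ≥ 0`: the Schrödinger group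
for `z = i t` and the heat semigroup for `z = δ > 0`. It is the Fourier multiplier with symbol
`exp (-z |ξ|²)`, see `fourier_expLaplacian`; in Mathlib's normalization of the Fourier transform
this symbol reads `exp (-z |2πξ|²)`. -/
def expLaplacian {n : ℕ} (z : ℂ) (u : TemperedDistribution (EuclideanSpace ℝ (Fin n)) ℂ) :
    TemperedDistribution (EuclideanSpace ℝ (Fin n)) ℂ :=
  TemperedDistribution.fourierMultiplierCLM ℂ
    (fun ξ ↦ gaussian (-z) ((2 * Real.pi) • ξ)) u

theorem dilation_symm_apply {n : ℕ} (x : EuclideanSpace ℝ (Fin n)) :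
    (dilation n).symm x = (2 * Real.pi) • x := by
  rw [ContinuousLinearEquiv.symm_apply_eq]
  change x = (2 * Real.pi)⁻¹ • (2 * Real.pi) • x
  rw [smul_smul, inv_mul_cancel₀ (by positivity), one_smul]

theorem schwartzFourier_eq {n : ℕ} (φ : 𝓢(EuclideanSpace ℝ (Fin n), ℂ)) :
    schwartzFourier n φ =
      (((2 * Real.pi) ^ (-(n : ℝ) / 2) * (2 * Real.pi) ^ n : ℝ) : ℂ) •
        𝓕 (SchwartzMap.compCLMOfContinuousLinearEquiv ℂ (dilation n).symm φ) := by
  ext ξ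
  have h1 : schwartzFourier n φ ξ = (((2 * Real.pi) ^ (-(n : ℝ) / 2) : ℝ) : ℂ) *
    (𝓕 φ) ((2 * Real.pi)⁻¹ • ξ) := rfl
  rw [h1, smul_apply, SchwartzMap.fourier_coe, SchwartzMap.fourier_coe,
    Real.fourier_eq', Real.fourier_eq', smul_eq_mul, Complex.ofReal_mul, mul_assoc]
  congr 1
  have h2 := Measure.integral_comp_smul (volume : Measure (EuclideanSpace ℝ (Fin n)))
    (fun v ↦ Complex.exp (((-2 * Real.pi * inner ℝ v ((2 * Real.pi)⁻¹ • ξ) : ℝ) : ℂ) *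
      Complex.I) • φ v) (2 * Real.pi)
  have h3 : ∀ v : EuclideanSpace ℝ (Fin n),
      inner ℝ ((2 * Real.pi) • v) ((2 * Real.pi)⁻¹ • ξ) = inner ℝ v ξ := by
    intro v
    rw [real_inner_smul_left, real_inner_smul_right, ← mul_assoc,
      mul_inv_cancel₀ (by positivity), one_mul]
  simp only [h3, finrank_euclideanSpace, Fintype.card_fin] at h2
  have h4 : ∀ v, SchwartzMap.compCLMOfContinuousLinearEquiv ℂ (dilation n).symm φ v =
      φ ((2 * Real.pi) • v) := fun v ↦ by rw [← dilation_symm_apply]; rfl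
  simp only [h4]
  rw [h2, abs_of_pos (by positivity), ← Complex.coe_smul, smul_eq_mul, ← mul_assoc,
    ← Complex.ofReal_mul, mul_inv_cancel₀ (by positivity), Complex.ofReal_one, one_mul]

theorem fourier_expLaplacian {n : ℕ} {z : ℂ} (hz : 0 ≤ z.re)
    (u : TemperedDistribution (EuclideanSpace ℝ (Fin n)) ℂ) :
    fourier (expLaplacian z u) = mulGaussian (-z) (fourier u) := by
  have hg : (gaussian (-z) : EuclideanSpace ℝ (Fin n) → ℂ).HasTemperateGrowth :=
    hasTemperateGrowth_gaussian (by simpa using hz)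
  have hg' : (fun ξ : EuclideanSpace ℝ (Fin n) ↦
      gaussian (-z) ((2 * Real.pi) • ξ)).HasTemperateGrowth :=
    hg.comp (((2 * Real.pi) • ContinuousLinearMap.id ℝ
      (EuclideanSpace ℝ (Fin n))).hasTemperateGrowth)
  ext φ
  rw [fourier_apply, expLaplacian, TemperedDistribution.fourierMultiplierCLM_apply_apply,
    mulGaussian, TemperedDistribution.smulLeftCLM_apply_apply, fourier_apply,
    schwartzFourier_eq, schwartzFourier_eq, FourierTransform.fourierInv_smul,
    FourierTransform.fourierInv_fourier_eq, map_smul, FourierTransform.fourier_smul]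
  congr 3
  ext x
  have h5 : ∀ (ψ : 𝓢(EuclideanSpace ℝ (Fin n), ℂ)) v,
      SchwartzMap.compCLMOfContinuousLinearEquiv ℂ (dilation n).symm ψ v =
        ψ ((2 * Real.pi) • v) := fun ψ v ↦ by rw [← dilation_symm_apply]; rfl
  rw [h5, SchwartzMap.smulLeftCLM_apply_apply hg', SchwartzMap.smulLeftCLM_apply_apply hg, h5]

/-- The tempered distribution `u` is the function `f`: `u(φ) = ∫ φ f` for Schwartz `φ`. -/
def IsFunction {n : ℕ} (u : TemperedDistribution (EuclideanSpace ℝ (Fin n)) ℂ)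
    (f : EuclideanSpace ℝ (Fin n) → ℂ) : Prop :=
  ∀ φ : 𝓢(EuclideanSpace ℝ (Fin n), ℂ),
    Integrable (fun x ↦ φ x * f x) volume ∧ u φ = ∫ x, φ x * f x

/-- `u ∈ L²(exp (a |x|²) dx)`. -/
def MemGaussianL2 {n : ℕ} (a : ℝ) (u : TemperedDistribution (EuclideanSpace ℝ (Fin n)) ℂ) :
    Prop :=
  ∃ f : EuclideanSpace ℝ (Fin n) → ℂ,
    MemLp f 2 (volume.withDensity fun x ↦ ENNReal.ofReal (Real.exp (a * ‖x‖ ^ 2))) ∧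
      IsFunction u f

/-- The point `x + i y` of `ℂⁿ`. -/
def complexPoint {n : ℕ} (x y : EuclideanSpace ℝ (Fin n)) : EuclideanSpace ℂ (Fin n) :=
  WithLp.toLp 2 fun j ↦ (x j : ℂ) + Complex.I * (y j : ℂ)

/-- `u` and its Fourier transform both have Gaussian decay in the `L²` sense. -/
def HasGaussianDecay {n : ℕ} (u : TemperedDistribution (EuclideanSpace ℝ (Fin n)) ℂ) : Prop :=
  ∃ b₁ b₂ : ℝ, 0 < b₁ ∧ 0 < b₂ ∧ MemGaussianL2 b₁ u ∧ MemGaussianL2 b₂ (fourier u)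

/-- `u` is the restriction to `ℝⁿ` of an entire function `F` on `ℂⁿ` such that
`|F(x + i y)| ≤ N exp (-a |x|² + b |y|²)` for some constants `N, a, b > 0`. -/
def HasGaussianExtension {n : ℕ} (u : TemperedDistribution (EuclideanSpace ℝ (Fin n)) ℂ) :
    Prop :=
  ∃ F : EuclideanSpace ℂ (Fin n) → ℂ, Differentiable ℂ F ∧
    IsFunction u (fun x ↦ F (complexPoint x 0)) ∧
    ∃ N a b : ℝ, 0 < N ∧ 0 < a ∧ 0 < b ∧ ∀ x y : EuclideanSpace ℝ (Fin n),
      ‖F (complexPoint x y)‖ ≤ N * Real.exp (-a * ‖x‖ ^ 2 + b * ‖y‖ ^ 2)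

end GaussianDecay

end

/-!
Gaussian decay of `u` makes the Fourier transform of `u` entire, with Gaussian growth in the
imaginary directions only. If an entire `F` and its chirp `exp (iκ z·z) F` (`κ ≠ 0`) both have
such growth, then at `x + iy` the bound on the chirp improves the one on `F` by a factor
`exp (-2|κ x·y|)` wherever `κ x·y < 0`, and a maximum principle on the complex lines through
`x + iy` in the direction `x` turns this gain into Gaussian decay in `x`. This is exactly what (i)
provides, since `exp (itΔ)` multiplies the Fourier transform by a chirp. For (ii) one uses that
chirp, Fourier transform, chirp is, up to a constant, a conjugate of multiplication by a chirp
under the Fourier transform. All other implications hold because entire functions with Gaussian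
decay are stable under the Fourier transform, by shifting the contour of integration, and under
multiplication by small Gaussians.
-/

noncomputable section

namespace GaussianDecay

section ComplexAnalysis

theorem eq_of_eq_ofReal {f g : ℂ → ℂ} (hf : Differentiable ℂ f) (hg : Differentiable ℂ g)
    (h : ∀ s : ℝ, f s = g s) : f = g := by
  refine AnalyticOnNhd.eq_of_frequently_eq (z₀ := 0) (fun c _ ↦ hf.analyticAt c)
    (fun c _ ↦ hg.analyticAt c) ?_
  have hlim : Filter.Tendsto (fun s : ℝ ↦ (s : ℂ)) (nhdsWithin 0 {0}ᶜ) (nhdsWithin 0 {0}ᶜ) := by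
    have := Complex.continuous_ofReal.continuousAt.continuousWithinAt.tendsto_nhdsWithin
      (x := (0 : ℝ)) (s := {0}ᶜ) (t := {0}ᶜ) fun s hs ↦ by simpa using hs
    simpa using this
  exact hlim.frequently (Filter.Eventually.of_forall h).frequently

/-- The maximum principle for `f exp (-P)`. -/
theorem norm_le_mul_exp_re_of_sphere {f P : ℂ → ℂ} (hf : Differentiable ℂ f)
    (hP : Differentiable ℂ P) {c : ℂ} {R N : ℝ} (hR : 0 < R)
    (hle : ∀ z ∈ Metric.sphere c R, ‖f z‖ ≤ N * Real.exp (P z).re) :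
    ‖f c‖ ≤ N * Real.exp (P c).re := by
  have hnorm (z : ℂ) : ‖f z * Complex.exp (-P z)‖ = ‖f z‖ / Real.exp (P z).re := by
    rw [norm_mul, Complex.norm_exp, Complex.neg_re, Real.exp_neg, div_eq_mul_inv]
  rw [← div_le_iff₀ (Real.exp_pos _), ← hnorm]
  have hfP : Differentiable ℂ fun z ↦ f z * Complex.exp (-P z) := by fun_prop
  refine Complex.norm_le_of_forall_mem_frontier_norm_le Metric.isBounded_ball hfP.diffContOnCl
    (fun z hz ↦ ?_) (subset_closure (Metric.mem_ball_self hR))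
  rw [hnorm, div_le_iff₀ (Real.exp_pos _)]
  exact hle z (by rwa [frontier_ball c hR.ne'] at hz)

/-- Cauchy's estimate turns a local integrable bound for the integrand into one for its
derivative. -/
theorem differentiable_integral_mul_of_dominated {E α : Type*} [NormedAddCommGroup E]
    [NormedSpace ℂ E] [FiniteDimensional ℂ E] [TopologicalSpace α] [MeasurableSpace α]
    [OpensMeasurableSpace α] [SecondCountableTopology α] {μ : Measure α} {f : α → ℂ}
    {k : α → E → ℂ} (hf : AEStronglyMeasurable f μ) (hk : Continuous k.uncurry)
    (hdiff : ∀ x, Differentiable ℂ (k x))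
    (hbound : ∀ z₀, ∃ g : α → ℝ, Integrable g μ ∧
      ∀ z ∈ Metric.ball z₀ 2, ∀ x, ‖k x z * f x‖ ≤ g x) :
    Differentiable ℂ fun z ↦ ∫ x, k x z * f x ∂μ := by
  intro z₀
  obtain ⟨g, hg, hgk⟩ := hbound z₀
  have hmeas (z : E) : AEStronglyMeasurable (fun x ↦ k x z * f x) μ :=
    (hk.comp (Continuous.prodMk_left z)).aestronglyMeasurable.mul hf
  have hdiff' (x : α) : Differentiable ℂ fun z ↦ k x z * f x := (hdiff x).mul_const _
  have hmeas' : AEStronglyMeasurable (fun x ↦ fderiv ℂ (fun z ↦ k x z * f x) z₀) μ := by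
    simp only [fun x ↦ fderiv_mul_const (hdiff x z₀) (f x)]
    borelize E
    have := FiniteDimensional.proper ℂ E
    have := FiniteDimensional.proper ℂ (E →L[ℂ] ℂ)
    exact hf.smul ((measurable_fderiv_with_param ℂ hk).comp
      (measurable_id.prodMk measurable_const)).aestronglyMeasurable
  have hfderiv : ∀ x, ∀ z ∈ Metric.ball z₀ 1, ‖fderiv ℂ (fun z ↦ k x z * f x) z‖ ≤ 2 * g x := by
    intro x z hz
    have hball : Metric.ball z 1 ⊆ Metric.ball z₀ 2 :=
      Metric.ball_subset_ball' (by rw [Metric.mem_ball] at hz; linarith)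
    have := Complex.norm_fderiv_le_div_of_mapsTo_ball (hdiff' x).differentiableOn
      (R₂ := 2 * g x) (fun w hw ↦ ?_) (one_pos (α := ℝ)) (c := z)
    · simpa using this
    · rw [mem_closedBall_iff_norm, two_mul]
      exact norm_sub_le_of_le (hgk w (hball hw) x)
        (hgk z (hball (Metric.mem_ball_self one_pos)) x)
  exact (hasFDerivAt_integral_of_dominated_of_fderiv_le (Metric.ball_mem_nhds z₀ one_pos)
    (.of_forall hmeas)
    (hg.mono' (hmeas z₀) (.of_forall fun x ↦ hgk z₀ (Metric.mem_ball_self two_pos) x)) hmeas'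
    (.of_forall hfderiv) (hg.const_mul 2)
    (.of_forall fun x z _ ↦ (hdiff' x z).hasFDerivAt)).differentiableAt

end ComplexAnalysis

variable {n : ℕ}

section Gaussian

theorem norm_gaussian (c : ℂ) (x : EuclideanSpace ℝ (Fin n)) :
    ‖gaussian c x‖ = Real.exp (c.re * ‖x‖ ^ 2) := by
  rw [gaussian, Complex.norm_exp, Complex.re_mul_ofReal]

theorem norm_gaussian_le_one {c : ℂ} (hc : c.re ≤ 0) (x : EuclideanSpace ℝ (Fin n)) :
    ‖gaussian c x‖ ≤ 1 := by
  rw [norm_gaussian]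
  exact Real.exp_le_one_iff.2 (mul_nonpos_of_nonpos_of_nonneg hc (sq_nonneg _))

@[fun_prop]
theorem continuous_gaussian (c : ℂ) :
    Continuous (gaussian c : EuclideanSpace ℝ (Fin n) → ℂ) := by
  unfold gaussian
  fun_prop

theorem gaussian_zero (x : EuclideanSpace ℝ (Fin n)) : gaussian 0 x = 1 := by
  rw [gaussian, zero_mul, Complex.exp_zero]

theorem gaussian_mul_gaussian (c d : ℂ) (x : EuclideanSpace ℝ (Fin n)) :
    gaussian c x * gaussian d x = gaussian (c + d) x := by
  rw [gaussian, gaussian, gaussian, ← Complex.exp_add, add_mul]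

theorem gaussian_neg_mul_gaussian_mul (c z : ℂ) (x : EuclideanSpace ℝ (Fin n)) :
    gaussian (-c) x * (gaussian c x * z) = z := by
  rw [← mul_assoc, gaussian_mul_gaussian, neg_add_cancel, gaussian_zero, one_mul]

theorem integrable_gaussian {c : ℂ} (hc : c.re < 0) :
    Integrable (gaussian c : EuclideanSpace ℝ (Fin n) → ℂ) := by
  change Integrable fun x : EuclideanSpace ℝ (Fin n) ↦ gaussian c x
  simpa [gaussian] using GaussianFourier.integrable_cexp_neg_mul_sq_norm_add
    (V := EuclideanSpace ℝ (Fin n)) (b := -c) (by simpa using hc) 0 0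

theorem integrable_exp_neg_mul_norm_sq {a : ℝ} (ha : 0 < a) :
    Integrable fun x : EuclideanSpace ℝ (Fin n) ↦ Real.exp (-a * ‖x‖ ^ 2) := by
  simpa only [norm_gaussian, Complex.neg_re, Complex.ofReal_re] using
    (integrable_gaussian (n := n) (c := -(a : ℂ)) (by simpa using ha)).norm

end Gaussian

section ComplexSpace

theorem complexPoint_apply (x y : EuclideanSpace ℝ (Fin n)) (j : Fin n) :
    complexPoint x y j = (x j : ℂ) + Complex.I * (y j : ℂ) := rfl

theorem complexPoint_add_smul (x y v : EuclideanSpace ℝ (Fin n)) (c : ℂ) :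
    complexPoint x y + c • complexPoint v 0 = complexPoint (x + c.re • v) (y + c.im • v) := by
  ext j
  simp only [PiLp.add_apply, PiLp.smul_apply, complexPoint_apply, PiLp.zero_apply, smul_eq_mul]
  conv_lhs => rw [← Complex.re_add_im c]
  push_cast
  ring

theorem exists_complexPoint_eq (z : EuclideanSpace ℂ (Fin n)) : ∃ x y, complexPoint x y = z :=
  ⟨WithLp.toLp 2 fun j ↦ (z j).re, WithLp.toLp 2 fun j ↦ (z j).im, by
    ext j
    simp [complexPoint_apply, mul_comm Complex.I, Complex.re_add_im]⟩

theorem norm_complexPoint_sq (x y : EuclideanSpace ℝ (Fin n)) :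
    ‖complexPoint x y‖ ^ 2 = ‖x‖ ^ 2 + ‖y‖ ^ 2 := by
  simp only [EuclideanSpace.norm_sq_eq, complexPoint_apply, ← Finset.sum_add_distrib,
    ← Complex.normSq_eq_norm_sq, mul_comm Complex.I, Complex.normSq_add_mul_I, Real.norm_eq_abs,
    sq_abs]

@[fun_prop]
theorem continuous_complexPoint {α : Type*} [TopologicalSpace α]
    {f g : α → EuclideanSpace ℝ (Fin n)} (hf : Continuous f) (hg : Continuous g) :
    Continuous fun t ↦ complexPoint (f t) (g t) := by
  unfold complexPoint
  fun_prop

theorem continuous_restrict {F : EuclideanSpace ℂ (Fin n) → ℂ} (hF : Differentiable ℂ F) :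
    Continuous fun x ↦ F (complexPoint x 0) :=
  hF.continuous.comp (by fun_prop)

theorem eq_of_eqOn_real {F G : EuclideanSpace ℂ (Fin n) → ℂ} (hF : Differentiable ℂ F)
    (hG : Differentiable ℂ G) (h : ∀ x, F (complexPoint x 0) = G (complexPoint x 0)) : F = G := by
  ext z
  obtain ⟨x, y, rfl⟩ := exists_complexPoint_eq z
  have heq := eq_of_eq_ofReal
    (f := fun c ↦ F (complexPoint x 0 + c • complexPoint y 0))
    (g := fun c ↦ G (complexPoint x 0 + c • complexPoint y 0)) (by fun_prop) (by fun_prop)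
    fun s ↦ by
      simp only [complexPoint_add_smul, Complex.ofReal_re, Complex.ofReal_im, zero_smul,
        add_zero, h]
  simpa [complexPoint_add_smul] using congrFun heq Complex.I

/-- The complex bilinear form `z · w = ∑ⱼ zⱼ wⱼ` on `ℂⁿ`, without conjugation, so that it is
holomorphic in both variables. -/
def dot (z w : EuclideanSpace ℂ (Fin n)) : ℂ := ∑ j, z j * w j

theorem dot_complexPoint (x y ξ η : EuclideanSpace ℝ (Fin n)) :
    dot (complexPoint x y) (complexPoint ξ η) =
      ((inner ℝ x ξ - inner ℝ y η : ℝ) : ℂ) +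
        ((inner ℝ x η + inner ℝ y ξ : ℝ) : ℂ) * Complex.I := by
  simp only [dot, complexPoint_apply, PiLp.inner_apply, RCLike.inner_apply, conj_trivial,
    ← Finset.sum_sub_distrib, ← Finset.sum_add_distrib, Complex.ofReal_sum, Finset.sum_mul]
  refine Finset.sum_congr rfl fun j _ ↦ ?_
  push_cast
  linear_combination (y j * η j : ℂ) * Complex.I_sq

theorem dot_self_complexPoint (x y : EuclideanSpace ℝ (Fin n)) :
    dot (complexPoint x y) (complexPoint x y) =
      ((‖x‖ ^ 2 - ‖y‖ ^ 2 : ℝ) : ℂ) + ((2 * inner ℝ x y : ℝ) : ℂ) * Complex.I := by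
  rw [dot_complexPoint, real_inner_self_eq_norm_sq, real_inner_self_eq_norm_sq,
    real_inner_comm x y, ← two_mul]

@[fun_prop]
theorem differentiable_dot {E : Type*} [NormedAddCommGroup E] [NormedSpace ℂ E]
    {f g : E → EuclideanSpace ℂ (Fin n)} (hf : Differentiable ℂ f) (hg : Differentiable ℂ g) :
    Differentiable ℂ fun t ↦ dot (f t) (g t) := by
  unfold dot
  fun_prop

@[fun_prop]
theorem continuous_dot {α : Type*} [TopologicalSpace α] {f g : α → EuclideanSpace ℂ (Fin n)}
    (hf : Continuous f) (hg : Continuous g) : Continuous fun t ↦ dot (f t) (g t) := by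
  unfold dot
  fun_prop

theorem norm_exp_mul_dot_self (c : ℂ) (x y : EuclideanSpace ℝ (Fin n)) :
    ‖Complex.exp (c * dot (complexPoint x y) (complexPoint x y))‖ =
      Real.exp (c.re * (‖x‖ ^ 2 - ‖y‖ ^ 2) - c.im * (2 * inner ℝ x y)) := by
  rw [Complex.norm_exp, dot_self_complexPoint, Complex.mul_re]
  simp only [Complex.add_re, Complex.add_im, Complex.ofReal_re, Complex.ofReal_im,
    Complex.re_ofReal_mul, Complex.im_ofReal_mul, Complex.I_re, Complex.I_im, mul_zero, mul_one,
    add_zero, zero_add]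

theorem exp_mul_dot_self_complexPoint_zero (c : ℂ) (x : EuclideanSpace ℝ (Fin n)) :
    Complex.exp (c * dot (complexPoint x 0) (complexPoint x 0)) = gaussian c x := by
  rw [dot_self_complexPoint, gaussian]
  simp

theorem norm_exp_neg_I_mul_dot (x y ξ η : EuclideanSpace ℝ (Fin n)) :
    ‖Complex.exp (-Complex.I * dot (complexPoint x y) (complexPoint ξ η))‖ =
      Real.exp (inner ℝ x η + inner ℝ y ξ) := by
  rw [Complex.norm_exp, dot_complexPoint]
  simp

end ComplexSpace

section GaussianBound

variable {a b : ℝ} {F G : EuclideanSpace ℂ (Fin n) → ℂ}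

/-- The bound `|F(x + iy)| ≤ N exp (-a|x|² + b|y|²)` for some `N, b > 0`. The rate `a` may have any
sign: for `a = 0` this is Gaussian growth in the imaginary directions, without decay. -/
def GaussianBound (a : ℝ) (F : EuclideanSpace ℂ (Fin n) → ℂ) : Prop :=
  ∃ N b : ℝ, 0 < N ∧ 0 < b ∧ ∀ x y,
    ‖F (complexPoint x y)‖ ≤ N * Real.exp (-a * ‖x‖ ^ 2 + b * ‖y‖ ^ 2)

theorem GaussianBound.mul (hF : GaussianBound a F) (hG : GaussianBound b G) :
    GaussianBound (a + b) fun z ↦ F z * G z := by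
  obtain ⟨N₁, b₁, hN₁, hb₁, hF⟩ := hF
  obtain ⟨N₂, b₂, hN₂, hb₂, hG⟩ := hG
  refine ⟨N₁ * N₂, b₁ + b₂, by positivity, by positivity, fun x y ↦ ?_⟩
  calc ‖F (complexPoint x y) * G (complexPoint x y)‖
      ≤ N₁ * Real.exp (-a * ‖x‖ ^ 2 + b₁ * ‖y‖ ^ 2) *
          (N₂ * Real.exp (-b * ‖x‖ ^ 2 + b₂ * ‖y‖ ^ 2)) :=
        norm_mul_le_of_le (hF x y) (hG x y)
    _ = N₁ * N₂ * Real.exp (-(a + b) * ‖x‖ ^ 2 + (b₁ + b₂) * ‖y‖ ^ 2) := by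
        rw [mul_mul_mul_comm, ← Real.exp_add]
        ring_nf

theorem inner_le_mul_norm_sq_add {V : Type*} [NormedAddCommGroup V] [InnerProductSpace ℝ V]
    {ε : ℝ} (hε : 0 < ε) (x y : V) : inner ℝ x y ≤ ε * ‖x‖ ^ 2 + (4 * ε)⁻¹ * ‖y‖ ^ 2 := by
  have hsq : ε * ‖x‖ ^ 2 + (4 * ε)⁻¹ * ‖y‖ ^ 2 - ‖x‖ * ‖y‖ =
      ε * (‖x‖ - (2 * ε)⁻¹ * ‖y‖) ^ 2 := by
    field_simp
    ring
  have hnonneg : 0 ≤ ε * (‖x‖ - (2 * ε)⁻¹ * ‖y‖) ^ 2 := by positivity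
  linarith [real_inner_le_norm x y]

theorem gaussianBound_exp_mul_dot_self {c : ℂ} (ha : a < -c.re) :
    GaussianBound a fun z : EuclideanSpace ℂ (Fin n) ↦ Complex.exp (c * dot z z) := by
  have hε : 0 < -c.re - a := by linarith
  refine ⟨1, |c.re| + (4 * (-c.re - a))⁻¹ * (2 * c.im) ^ 2 + 1, one_pos, by positivity,
    fun x y ↦ ?_⟩
  have hinner := inner_le_mul_norm_sq_add hε x ((-(2 * c.im)) • y)
  rw [norm_smul, mul_pow, Real.norm_eq_abs, sq_abs, neg_sq, real_inner_smul_right] at hinner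
  have hre : -c.re * ‖y‖ ^ 2 ≤ |c.re| * ‖y‖ ^ 2 := by
    gcongr
    exact neg_le_abs _
  rw [norm_exp_mul_dot_self, one_mul, Real.exp_le_exp]
  nlinarith [sq_nonneg ‖y‖]

theorem gaussianBound_exp_neg_I_mul_dot (ha : a < 0) (w : EuclideanSpace ℂ (Fin n)) :
    GaussianBound a fun z ↦ Complex.exp (-Complex.I * dot z w) := by
  obtain ⟨ξ, η, rfl⟩ := exists_complexPoint_eq w
  refine ⟨Real.exp ((4 * -a)⁻¹ * ‖η‖ ^ 2 + (4 * 1)⁻¹ * ‖ξ‖ ^ 2), 1, Real.exp_pos _, one_pos,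
    fun x y ↦ ?_⟩
  rw [norm_exp_neg_I_mul_dot, ← Real.exp_add, Real.exp_le_exp]
  linarith [inner_le_mul_norm_sq_add (neg_pos.2 ha) x η, inner_le_mul_norm_sq_add one_pos y ξ]

theorem GaussianBound.integrable (hF : GaussianBound a F) (hFc : Continuous F) (ha : 0 < a)
    (y : EuclideanSpace ℝ (Fin n)) : Integrable fun x ↦ F (complexPoint x y) := by
  obtain ⟨N, b, -, -, hF⟩ := hF
  refine ((integrable_exp_neg_mul_norm_sq ha).const_mul (N * Real.exp (b * ‖y‖ ^ 2))).mono'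
    (by fun_prop : Continuous _).aestronglyMeasurable (.of_forall fun x ↦ (hF x y).trans_eq ?_)
  rw [Real.exp_add]
  ring

theorem le_mul_exp_add_mul {M N A B φ : ℝ} (hN : 0 ≤ N) (hφ₀ : 0 ≤ φ) (hφ₁ : φ ≤ 1)
    (h₁ : M ≤ N * Real.exp A) (h₂ : M ≤ N * Real.exp (A + B)) :
    M ≤ N * Real.exp (A + φ * B) := by
  rcases le_total 0 B with hB | hB
  · refine h₁.trans ?_
    gcongr
    exact le_add_of_nonneg_right (mul_nonneg hφ₀ hB)
  · refine h₂.trans ?_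
    gcongr
    nlinarith

theorem norm_add_smul_sq {V : Type*} [NormedAddCommGroup V] [InnerProductSpace ℝ V] (x y : V)
    (t : ℝ) : ‖y + t • x‖ ^ 2 = ‖y‖ ^ 2 + 2 * t * inner ℝ x y + t ^ 2 * ‖x‖ ^ 2 := by
  rw [norm_add_sq_real, real_inner_smul_right, norm_smul, mul_pow, Real.norm_eq_abs, sq_abs,
    real_inner_comm]
  ring

theorem inner_add_smul_self_add_smul {V : Type*} [NormedAddCommGroup V] [InnerProductSpace ℝ V]
    (x y : V) (s t : ℝ) :
    inner ℝ (x + s • x) (y + t • x) = (1 + s) * (inner ℝ x y + t * ‖x‖ ^ 2) := by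
  simp only [inner_add_left, inner_add_right, real_inner_smul_left, real_inner_smul_right,
    real_inner_self_eq_norm_sq]
  ring

/-- On the circle `|ζ| = |r|` in the complex line through `x + iy` in direction `x`, interpolate
between the two bounds with the weights `(1 ± Im ζ / r) / 2`. The resulting exponent is a cubic
polynomial in `Re ζ` and `Im ζ`, which agrees on the circle with the harmonic function `Re P`. -/
theorem norm_le_of_chirp {N r : ℝ} (hF : Differentiable ℂ F) (hN : 0 ≤ N) (hr : r ≠ 0)
    (h₁ : ∀ x y, ‖F (complexPoint x y)‖ ≤ N * Real.exp (b * ‖y‖ ^ 2))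
    (h₂ : ∀ x y, ‖F (complexPoint x y)‖ ≤
      N * Real.exp (b * ‖y‖ ^ 2 + 2 * (2 * b * r) * inner ℝ x y))
    (x y : EuclideanSpace ℝ (Fin n)) :
    ‖F (complexPoint x y)‖ ≤
      N * Real.exp (b * ‖y‖ ^ 2 + 2 * b * r * inner ℝ x y - b * r ^ 2 / 2 * ‖x‖ ^ 2) := by
  set p : ℝ := inner ℝ x y
  set α : ℝ := 2 * b * r * p - b * r ^ 2 / 2 * ‖x‖ ^ 2 with hα
  set β : ℝ := 2 * b * r * ‖x‖ ^ 2 with hβ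
  set γ : ℝ := b * ‖x‖ ^ 2 / 2 with hγ
  let P (ζ : ℂ) : ℂ := (b * ‖y‖ ^ 2 + α : ℝ) + α * ζ - Complex.I * β * ζ
    - Complex.I * (β / 2 - b * p : ℝ) * ζ ^ 2 + γ * (ζ ^ 2 + ζ ^ 3)
  have hP (s t : ℝ) : (P (s + t * Complex.I)).re = b * ‖y‖ ^ 2 + α + α * s + β * t +
      (β - 2 * b * p) * (s * t) + γ * (s ^ 2 - t ^ 2 + s ^ 3 - 3 * s * t ^ 2) := by
    simp [P, pow_succ]
    ring
  have hsphere := norm_le_mul_exp_re_of_sphere (N := N) (c := 0) (R := |r|) (P := P)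
    (f := fun ζ ↦ F (complexPoint x y + ζ • complexPoint x 0)) (by fun_prop) (by fun_prop)
    (abs_pos.2 hr) fun ζ hζ ↦ ?_
  · rw [show P 0 = P ((0 : ℝ) + (0 : ℝ) * Complex.I) by simp, hP] at hsphere
    simpa [hα, add_sub_assoc] using hsphere
  obtain ⟨s, t, rfl⟩ : ∃ s t : ℝ, (s + t * Complex.I : ℂ) = ζ := ⟨_, _, Complex.re_add_im ζ⟩
  have hst : s ^ 2 + t ^ 2 = r ^ 2 := by
    rw [mem_sphere_zero_iff_norm] at hζ
    rw [← sq_abs r, ← hζ, Complex.sq_norm, Complex.normSq_add_mul_I]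
  have ht : |t / r| ≤ 1 := by
    rw [abs_div, div_le_one (abs_pos.2 hr)]
    exact sq_le_sq.1 (by linarith [sq_nonneg s])
  have hexp : b * ‖y + t • x‖ ^ 2 +
      (1 - t / r) / 2 * (2 * (2 * b * r) * inner ℝ (x + s • x) (y + t • x)) =
        (P (s + t * Complex.I)).re := by
    rw [hP, norm_add_smul_sq, inner_add_smul_self_add_smul, hα, hβ, hγ]
    field_simp
    linear_combination (-(b * ‖x‖ ^ 2 * (1 + s))) * hst
  rw [complexPoint_add_smul]
  simp only [Complex.add_re, Complex.add_im, Complex.ofReal_re, Complex.ofReal_im,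
    Complex.re_ofReal_mul, Complex.im_ofReal_mul, Complex.I_re, Complex.I_im, mul_zero, mul_one,
    add_zero, zero_add]
  rw [← hexp]
  exact le_mul_exp_add_mul hN (by linarith [(abs_le.1 ht).2]) (by linarith [(abs_le.1 ht).1])
    (h₁ _ _) (h₂ _ _)

theorem GaussianBound.exists_pos_of_chirp {κ : ℝ} (hκ : κ ≠ 0) (hF : Differentiable ℂ F)
    (h₁ : GaussianBound 0 F)
    (h₂ : GaussianBound 0 fun z ↦ Complex.exp (Complex.I * κ * dot z z) * F z) :
    ∃ a > 0, GaussianBound a F := by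
  obtain ⟨N₁, b₁, hN₁, hb₁, h₁⟩ := h₁
  obtain ⟨N₂, b₂, hN₂, hb₂, h₂⟩ := h₂
  have hchirp (x y) : ‖F (complexPoint x y)‖ ≤
      N₂ * Real.exp (b₂ * ‖y‖ ^ 2 + 2 * κ * inner ℝ x y) := by
    have := h₂ x y
    rw [norm_mul, norm_exp_mul_dot_self, ← le_div_iff₀' (Real.exp_pos _), mul_div_assoc,
      ← Real.exp_sub] at this
    refine this.trans_eq ?_
    congr 2
    simp
    ring
  set b := b₁ + b₂
  have hκ' : 2 * b * (κ / (2 * b)) = κ := by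
    have : b ≠ 0 := by positivity
    field_simp
  have hbound := norm_le_of_chirp (b := b) (N := N₁ + N₂) (r := κ / (2 * b)) hF (by positivity)
    (by positivity) (fun x y ↦ (h₁ x y).trans ?_) fun x y ↦ (hchirp x y).trans ?_
  · refine ⟨b * (κ / (2 * b)) ^ 2 / 4, by positivity, N₁ + N₂, 5 * b, by positivity, by positivity,
      fun x y ↦ (hbound x y).trans ?_⟩
    gcongr
    have hamgm := inner_le_mul_norm_sq_add (ε := 1 / 8) (by norm_num) ((κ / (2 * b)) • x) y
    rw [norm_smul, mul_pow, Real.norm_eq_abs, sq_abs, real_inner_smul_left] at hamgm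
    nlinarith
  · rw [neg_zero, zero_mul, zero_add]
    gcongr
    all_goals linarith
  · rw [hκ']
    gcongr
    all_goals linarith

end GaussianBound

section FourierLaplace

variable {a : ℝ} {F : EuclideanSpace ℂ (Fin n) → ℂ} {f : EuclideanSpace ℝ (Fin n) → ℂ}

theorem norm_sq_le_two_mul_add {V : Type*} [SeminormedAddCommGroup V] (x v : V) :
    ‖x‖ ^ 2 ≤ 2 * (‖x + v‖ ^ 2 + ‖v‖ ^ 2) :=
  calc ‖x‖ ^ 2 = ‖(x + v) - v‖ ^ 2 := by rw [add_sub_cancel_right]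
    _ ≤ (‖x + v‖ + ‖v‖) ^ 2 := by gcongr; exact norm_sub_le _ _
    _ ≤ 2 * (‖x + v‖ ^ 2 + ‖v‖ ^ 2) := add_sq_le

/-- For real `c` the integral of `F(x + cy)` does not depend on `c`, and it is entire in `c`. -/
theorem GaussianBound.integral_complexPoint (hF : GaussianBound a F) (hFd : Differentiable ℂ F)
    (ha : 0 < a) (y : EuclideanSpace ℝ (Fin n)) :
    ∫ x, F (complexPoint x y) = ∫ x, F (complexPoint x 0) := by
  have hdiff : Differentiable ℂ fun c : ℂ ↦
      ∫ x, F (complexPoint x 0 + c • complexPoint y 0) * 1 := by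
    obtain ⟨N, b, hN, hb, hF⟩ := hF
    refine differentiable_integral_mul_of_dominated aestronglyMeasurable_const
      (hFd.continuous.comp (by fun_prop)) (fun x ↦ by fun_prop) fun c₀ ↦ ?_
    refine ⟨fun x ↦ N * Real.exp ((a + b) * ((‖c₀‖ + 2) * ‖y‖) ^ 2) *
        Real.exp (-(a / 2) * ‖x‖ ^ 2),
      (integrable_exp_neg_mul_norm_sq (half_pos ha)).const_mul _, fun c hc x ↦ ?_⟩
    have hc' : ‖c‖ ≤ ‖c₀‖ + 2 := by
      linarith [norm_le_norm_add_norm_sub' c c₀, mem_ball_iff_norm.1 hc]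
    have hre : ‖c.re • y‖ ^ 2 ≤ ((‖c₀‖ + 2) * ‖y‖) ^ 2 := by
      rw [norm_smul]
      gcongr
      exact (Complex.abs_re_le_norm c).trans hc'
    have him : ‖c.im • y‖ ^ 2 ≤ ((‖c₀‖ + 2) * ‖y‖) ^ 2 := by
      rw [norm_smul]
      gcongr
      exact (Complex.abs_im_le_norm c).trans hc'
    beta_reduce
    rw [mul_one, complexPoint_add_smul, zero_add, mul_assoc, ← Real.exp_add]
    refine (hF _ _).trans ?_
    gcongr N * Real.exp ?_
    nlinarith [norm_sq_le_two_mul_add x (c.re • y)]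
  have hconst := eq_of_eq_ofReal hdiff (differentiable_const (∫ x, F (complexPoint x 0)))
    fun s ↦ by
      simp only [complexPoint_add_smul, mul_one, Complex.ofReal_re, Complex.ofReal_im, zero_smul,
        add_zero]
      exact integral_add_right_eq_self (fun x ↦ F (complexPoint x 0)) (s • y)
  simpa [complexPoint_add_smul] using congrFun hconst Complex.I

/-- The Fourier–Laplace transform `ζ ↦ (2π)^(-n/2) ∫ exp (-i x·ζ) f(x) dx`, the extension to
`ζ ∈ ℂⁿ` of the Fourier transform of `f`. -/
def fourierLaplace (f : EuclideanSpace ℝ (Fin n) → ℂ) (ζ : EuclideanSpace ℂ (Fin n)) : ℂ :=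
  (((2 * Real.pi) ^ (-(n : ℝ) / 2) : ℝ) : ℂ) *
    ∫ x, Complex.exp (-Complex.I * dot (complexPoint x 0) ζ) * f x

theorem fourierLaplace_eq_integral_gaussian (f : EuclideanSpace ℝ (Fin n) → ℂ) (c : ℂ)
    (ζ : EuclideanSpace ℂ (Fin n)) :
    fourierLaplace f ζ = (((2 * Real.pi) ^ (-(n : ℝ) / 2) : ℝ) : ℂ) *
      ∫ x, Complex.exp (-Complex.I * dot (complexPoint x 0) ζ) * gaussian (-c) x *
        (gaussian c x * f x) := by
  simp only [fourierLaplace, mul_assoc, gaussian_neg_mul_gaussian_mul]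

theorem norm_exp_neg_I_mul_dot_mul_gaussian_le (ha : 0 < a) (x ξ η : EuclideanSpace ℝ (Fin n)) :
    ‖Complex.exp (-Complex.I * dot (complexPoint x 0) (complexPoint ξ η)) *
      gaussian (-(a : ℂ)) x‖ ≤ Real.exp ((4 * a)⁻¹ * ‖η‖ ^ 2) := by
  rw [norm_mul, norm_exp_neg_I_mul_dot, norm_gaussian, ← Real.exp_add, Real.exp_le_exp,
    Complex.neg_re, Complex.ofReal_re, inner_zero_left]
  linarith [inner_le_mul_norm_sq_add ha x η]

theorem differentiable_fourierLaplace (ha : 0 < a)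
    (hf : Integrable fun x ↦ gaussian (a : ℂ) x * f x) :
    Differentiable ℂ (fourierLaplace f) := by
  simp only [funext (fourierLaplace_eq_integral_gaussian f a)]
  refine .const_mul (differentiable_integral_mul_of_dominated hf.aestronglyMeasurable
    (by unfold Function.uncurry; fun_prop) (fun x ↦ by fun_prop) fun ζ₀ ↦
    ⟨fun x ↦ Real.exp ((4 * a)⁻¹ * (‖ζ₀‖ + 2) ^ 2) * ‖gaussian (a : ℂ) x * f x‖,
      hf.norm.const_mul _, fun ζ hζ x ↦ ?_⟩) _
  have hζ' : ‖ζ‖ ≤ ‖ζ₀‖ + 2 := by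
    linarith [norm_le_norm_add_norm_sub' ζ ζ₀, mem_ball_iff_norm.1 hζ]
  obtain ⟨ξ, η, rfl⟩ := exists_complexPoint_eq ζ
  have hη : ‖η‖ ^ 2 ≤ (‖ζ₀‖ + 2) ^ 2 :=
    calc ‖η‖ ^ 2 ≤ ‖complexPoint ξ η‖ ^ 2 := by
          rw [norm_complexPoint_sq]
          exact le_add_of_nonneg_left (sq_nonneg _)
      _ ≤ (‖ζ₀‖ + 2) ^ 2 := by gcongr
  rw [norm_mul]
  beta_reduce
  gcongr
  refine (norm_exp_neg_I_mul_dot_mul_gaussian_le ha x ξ η).trans ?_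
  gcongr

theorem gaussianBound_of_norm_le {N b : ℝ} (hb : 0 < b) (h : ∀ x y,
    ‖F (complexPoint x y)‖ ≤ N * Real.exp (-a * ‖x‖ ^ 2 + b * ‖y‖ ^ 2)) : GaussianBound a F :=
  ⟨|N| + 1, b, by positivity, hb, fun x y ↦ (h x y).trans <| by
    gcongr
    exact (le_abs_self N).trans (le_add_of_nonneg_right zero_le_one)⟩

theorem norm_ofReal_mul_integral_le {α : Type*} [MeasurableSpace α] {μ : Measure α} {k : α → ℂ}
    {g : α → ℝ} {C B : ℝ} (hC : 0 ≤ C) (hg : Integrable g μ) (h : ∀ x, ‖k x‖ ≤ g x * B) :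
    ‖(C : ℂ) * ∫ x, k x ∂μ‖ ≤ C * (∫ x, g x ∂μ) * B := by
  rw [norm_mul, Complex.norm_real, Real.norm_of_nonneg hC, mul_assoc, ← integral_mul_const]
  gcongr
  exact norm_integral_le_of_norm_le (hg.mul_const B) (.of_forall h)

theorem gaussianBound_zero_fourierLaplace (ha : 0 < a)
    (hf : Integrable fun x ↦ gaussian (a : ℂ) x * f x) : GaussianBound 0 (fourierLaplace f) := by
  refine gaussianBound_of_norm_le (b := (4 * a)⁻¹)
    (N := (2 * Real.pi) ^ (-(n : ℝ) / 2) * ∫ x, ‖gaussian (a : ℂ) x * f x‖)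
    (by positivity) fun ξ η ↦ ?_
  rw [fourierLaplace_eq_integral_gaussian f a, neg_zero, zero_mul, zero_add]
  refine norm_ofReal_mul_integral_le (by positivity) hf.norm fun x ↦ ?_
  rw [norm_mul, mul_comm]
  gcongr
  exact norm_exp_neg_I_mul_dot_mul_gaussian_le ha x ξ η

/-- Shift the contour to `ℝⁿ - iξ/(2b)`. -/
theorem GaussianBound.fourierLaplace (hF : GaussianBound a F) (hFd : Differentiable ℂ F)
    (ha : 0 < a) :
    ∃ a' > 0, GaussianBound a' (fourierLaplace fun x ↦ F (complexPoint x 0)) := by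
  have hG (ζ) : GaussianBound (-(a / 2) + a) fun z ↦ Complex.exp (-Complex.I * dot z ζ) * F z :=
    (gaussianBound_exp_neg_I_mul_dot (by linarith) ζ).mul hF
  obtain ⟨N, b, hN, hb, hF⟩ := hF
  refine ⟨(4 * b)⁻¹, by positivity,
    gaussianBound_of_norm_le (b := (2 * a)⁻¹) (N := (2 * Real.pi) ^ (-(n : ℝ) / 2) *
      ∫ x : EuclideanSpace ℝ (Fin n), N * Real.exp (-(a / 2) * ‖x‖ ^ 2))
    (by positivity) fun ξ η ↦ ?_⟩
  rw [GaussianDecay.fourierLaplace,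
    ← (hG _).integral_complexPoint (by fun_prop) (by linarith) (-(2 * b)⁻¹ • ξ)]
  refine norm_ofReal_mul_integral_le (by positivity)
    ((integrable_exp_neg_mul_norm_sq (half_pos ha)).const_mul N) fun x ↦ ?_
  have hx : inner ℝ x η ≤ a / 2 * ‖x‖ ^ 2 + (2 * a)⁻¹ * ‖η‖ ^ 2 := by
    convert inner_le_mul_norm_sq_add (half_pos ha) x η using 4
    ring
  have hξ : inner ℝ (-(2 * b)⁻¹ • ξ) ξ + b * ‖-(2 * b)⁻¹ • ξ‖ ^ 2 = -(4 * b)⁻¹ * ‖ξ‖ ^ 2 := by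
    rw [real_inner_smul_left, real_inner_self_eq_norm_sq, norm_smul, mul_pow, Real.norm_eq_abs,
      sq_abs]
    field_simp
    ring
  calc _ ≤ Real.exp (inner ℝ x η + inner ℝ (-(2 * b)⁻¹ • ξ) ξ) *
        (N * Real.exp (-a * ‖x‖ ^ 2 + b * ‖-(2 * b)⁻¹ • ξ‖ ^ 2)) := by
        rw [norm_mul, norm_exp_neg_I_mul_dot]
        gcongr
        exact hF _ _
    _ = N * Real.exp (inner ℝ x η - a * ‖x‖ ^ 2 + -(4 * b)⁻¹ * ‖ξ‖ ^ 2) := by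
        rw [mul_left_comm, ← Real.exp_add, ← hξ]
        ring_nf
    _ ≤ N * Real.exp (-(a / 2) * ‖x‖ ^ 2 + (-(4 * b)⁻¹ * ‖ξ‖ ^ 2 + (2 * a)⁻¹ * ‖η‖ ^ 2)) := by
        gcongr ?_ * Real.exp ?_
        linarith
    _ = _ := by rw [Real.exp_add, mul_assoc]

end FourierLaplace

section RealFrequencies

variable {f g : EuclideanSpace ℝ (Fin n) → ℂ}

theorem fourierLaplace_complexPoint_zero (f : EuclideanSpace ℝ (Fin n) → ℂ)
    (ξ : EuclideanSpace ℝ (Fin n)) :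
    fourierLaplace f (complexPoint ξ 0) = (((2 * Real.pi) ^ (-(n : ℝ) / 2) : ℝ) : ℂ) *
      ∫ x, Complex.exp (-Complex.I * ((inner ℝ x ξ : ℝ) : ℂ)) * f x := by
  simp only [fourierLaplace, dot_complexPoint, inner_zero_left, inner_zero_right, sub_zero,
    add_zero, Complex.ofReal_zero, zero_mul]

theorem fourierLaplace_eq_fourierIntegral (f : EuclideanSpace ℝ (Fin n) → ℂ)
    (ξ : EuclideanSpace ℝ (Fin n)) :
    fourierLaplace f (complexPoint ξ 0) = (((2 * Real.pi) ^ (-(n : ℝ) / 2) : ℝ) : ℂ) *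
      VectorFourier.fourierIntegral Real.probChar volume (innerₗ (EuclideanSpace ℝ (Fin n)))
        f ξ := by
  rw [fourierLaplace_complexPoint_zero, VectorFourier.fourierIntegral_probChar]
  simp only [innerₗ_apply_apply, smul_eq_mul, neg_mul, mul_comm Complex.I]

theorem schwartzFourier_eq_fourierLaplace (φ : 𝓢(EuclideanSpace ℝ (Fin n), ℂ))
    (ξ : EuclideanSpace ℝ (Fin n)) :
    schwartzFourier n φ ξ = fourierLaplace φ (complexPoint ξ 0) := by
  rw [schwartzFourier_apply, fourierLaplace_complexPoint_zero]

theorem continuous_fourierLaplace_real (hf : Integrable f) :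
    Continuous fun ξ ↦ fourierLaplace f (complexPoint ξ 0) := by
  simp only [fourierLaplace_eq_fourierIntegral]
  exact continuous_const.mul (VectorFourier.fourierIntegral_continuous Real.continuous_probChar
    continuous_inner hf)

theorem integral_fourierLaplace_mul (hf : Integrable f) (hg : Integrable g) :
    ∫ ξ, fourierLaplace f (complexPoint ξ 0) * g ξ =
      ∫ x, f x * fourierLaplace g (complexPoint x 0) := by
  have hflip := VectorFourier.integral_fourierIntegral_smul_eq_flip
    (L := innerₗ (EuclideanSpace ℝ (Fin n))) Real.continuous_probChar continuous_inner hf hg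
  rw [flip_innerₗ] at hflip
  simp only [fourierLaplace_eq_fourierIntegral, mul_assoc, mul_left_comm (f _), integral_const_mul]
  simpa only [smul_eq_mul] using congrArg (_ * ·) hflip

theorem fourierLaplace_gaussian_mul {b : ℂ} (hb : 0 < b.re) (x ζ : EuclideanSpace ℝ (Fin n)) :
    fourierLaplace
        (fun ξ ↦ Complex.exp (-Complex.I * ((inner ℝ ξ ζ : ℝ) : ℂ)) * gaussian (-b) ξ)
        (complexPoint x 0) =
      (((2 * Real.pi) ^ (-(n : ℝ) / 2) : ℝ) : ℂ) * (Real.pi / b) ^ (n / 2 : ℂ) *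
        gaussian (-(4 * b)⁻¹) (x + ζ) := by
  have hint := GaussianFourier.integral_cexp_neg_mul_sq_norm_add hb (-Complex.I) (x + ζ)
  rw [finrank_euclideanSpace_fin] at hint
  rw [fourierLaplace_complexPoint_zero, mul_assoc]
  congr 1
  convert hint using 3 with ξ
  · rw [gaussian, ← Complex.exp_add, ← Complex.exp_add, inner_add_left, real_inner_comm ξ x,
      real_inner_comm ξ ζ]
    push_cast
    ring_nf
  · rw [gaussian]
    simp
    field_simp

theorem tendsto_integral_gaussian_mul {ι : Type*} {l : Filter ι} [l.IsCountablyGenerated]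
    {c : ι → ℂ} {c₀ : ℂ} (hc : Filter.Tendsto c l (nhds c₀)) (hre : ∀ᶠ i in l, (c i).re ≤ 0)
    (hf : Integrable f) (v : EuclideanSpace ℝ (Fin n)) :
    Filter.Tendsto (fun i ↦ ∫ x, gaussian (c i) (x + v) * f x) l
      (nhds (∫ x, gaussian c₀ (x + v) * f x)) := by
  refine tendsto_integral_filter_of_dominated_convergence (fun x ↦ ‖f x‖)
    (.of_forall fun i ↦ ?_) (hre.mono fun i hi ↦ .of_forall fun x ↦ ?_) hf.norm
    (.of_forall fun x ↦ ?_)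
  · exact (by fun_prop : Continuous fun x ↦ gaussian (c i) (x + v)).aestronglyMeasurable.mul
      hf.aestronglyMeasurable
  · rw [norm_mul]
    exact mul_le_of_le_one_left (norm_nonneg _) (norm_gaussian_le_one hi _)
  · exact ((hc.mul_const _).cexp).mul_const _

theorem fourierLaplace_gaussian_mul_fourierLaplace_of_re_pos {b : ℂ} (hb : 0 < b.re)
    (hf : Integrable f) (ζ : EuclideanSpace ℝ (Fin n)) :
    fourierLaplace (fun ξ ↦ gaussian (-b) ξ * fourierLaplace f (complexPoint ξ 0))
        (complexPoint ζ 0) =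
      (((2 * Real.pi) ^ (-(n : ℝ) / 2) : ℝ) : ℂ) ^ 2 * (Real.pi / b) ^ (n / 2 : ℂ) *
        ∫ x, gaussian (-(4 * b)⁻¹) (x + ζ) * f x := by
  set C : ℂ := (((2 * Real.pi) ^ (-(n : ℝ) / 2) : ℝ) : ℂ) with hC
  have hint : Integrable fun ξ : EuclideanSpace ℝ (Fin n) ↦
      Complex.exp (-Complex.I * ((inner ℝ ξ ζ : ℝ) : ℂ)) * gaussian (-b) ξ :=
    (integrable_gaussian (by simpa using hb)).bdd_mul (c := 1)
      (by fun_prop : Continuous _).aestronglyMeasurable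
      (.of_forall fun ξ ↦ by simp [Complex.norm_exp])
  calc fourierLaplace (fun ξ ↦ gaussian (-b) ξ * fourierLaplace f (complexPoint ξ 0))
        (complexPoint ζ 0)
      = C * ∫ ξ, fourierLaplace f (complexPoint ξ 0) *
          (Complex.exp (-Complex.I * ((inner ℝ ξ ζ : ℝ) : ℂ)) * gaussian (-b) ξ) := by
        simp only [fourierLaplace_complexPoint_zero (fun _ ↦ _) ζ, hC, ← mul_assoc, mul_comm]
    _ = C * ∫ x, f x * (C * (Real.pi / b) ^ (n / 2 : ℂ) * gaussian (-(4 * b)⁻¹) (x + ζ)) := by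
        rw [integral_fourierLaplace_mul hf hint]
        simp only [fourierLaplace_gaussian_mul hb, hC]
    _ = C ^ 2 * (Real.pi / b) ^ (n / 2 : ℂ) * ∫ x, gaussian (-(4 * b)⁻¹) (x + ζ) * f x := by
        simp only [mul_left_comm (f _), mul_comm (f _), mul_assoc, integral_const_mul, sq]

theorem ofReal_div_mem_slitPlane {r : ℝ} {b : ℂ} (hr : 0 < r) (hb : 0 ≤ b.re) (hb₀ : b ≠ 0) :
    r / b ∈ Complex.slitPlane := by
  rw [Complex.mem_slitPlane_iff, div_eq_mul_inv, Complex.re_ofReal_mul, Complex.im_ofReal_mul,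
    Complex.inv_re, Complex.inv_im]
  have hnormSq := Complex.normSq_pos.2 hb₀
  rcases hb.lt_or_eq with hb | hb
  · exact .inl (by positivity)
  · have him : b.im ≠ 0 := fun h ↦ hb₀ (Complex.ext hb.symm h)
    exact .inr (mul_ne_zero hr.ne' (div_ne_zero (neg_ne_zero.2 him) hnormSq.ne'))

/-- Both sides are continuous up to the boundary of the half plane `Re b > 0`. -/
theorem fourierLaplace_gaussian_mul_fourierLaplace {b : ℂ} (hb : 0 ≤ b.re) (hb₀ : b ≠ 0)
    (hf : Integrable f) (hff : Integrable fun ξ ↦ fourierLaplace f (complexPoint ξ 0))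
    (ζ : EuclideanSpace ℝ (Fin n)) :
    fourierLaplace (fun ξ ↦ gaussian (-b) ξ * fourierLaplace f (complexPoint ξ 0))
        (complexPoint ζ 0) =
      (((2 * Real.pi) ^ (-(n : ℝ) / 2) : ℝ) : ℂ) ^ 2 * (Real.pi / b) ^ (n / 2 : ℂ) *
        ∫ x, gaussian (-(4 * b)⁻¹) (x + ζ) * f x := by
  set C : ℂ := (((2 * Real.pi) ^ (-(n : ℝ) / 2) : ℝ) : ℂ)
  have hlim : Filter.Tendsto (fun ε : ℝ ↦ b + ε) (nhdsWithin 0 (Set.Ioi 0)) (nhds b) := by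
    have : Continuous fun ε : ℝ ↦ b + ε := by fun_prop
    simpa using (this.tendsto 0).mono_left nhdsWithin_le_nhds
  have hre : ∀ᶠ ε : ℝ in nhdsWithin 0 (Set.Ioi 0), 0 < (b + ε).re := by
    filter_upwards [self_mem_nhdsWithin] with ε hε
    simpa using add_pos_of_nonneg_of_pos hb hε
  have hff' : Integrable fun ξ ↦ Complex.exp (-Complex.I * ((inner ℝ ξ ζ : ℝ) : ℂ)) *
      fourierLaplace f (complexPoint ξ 0) :=
    hff.bdd_mul (c := 1) (by fun_prop : Continuous _).aestronglyMeasurable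
      (.of_forall fun ξ ↦ by simp [Complex.norm_exp])
  have hleft : Filter.Tendsto (fun ε : ℝ ↦ fourierLaplace
      (fun ξ ↦ gaussian (-(b + ε)) ξ * fourierLaplace f (complexPoint ξ 0)) (complexPoint ζ 0))
      (nhdsWithin 0 (Set.Ioi 0)) (nhds (fourierLaplace
        (fun ξ ↦ gaussian (-b) ξ * fourierLaplace f (complexPoint ξ 0)) (complexPoint ζ 0))) := by
    simpa only [fourierLaplace_complexPoint_zero (fun _ ↦ _) ζ, mul_left_comm (gaussian _ _),
      add_zero] using (tendsto_integral_gaussian_mul hlim.neg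
        (hre.mono fun ε hε ↦ (neg_lt_zero.2 hε).le) hff' 0).const_mul C
  have hright : Filter.Tendsto (fun ε : ℝ ↦ C ^ 2 * (Real.pi / (b + ε)) ^ (n / 2 : ℂ) *
      ∫ x, gaussian (-(4 * (b + ε))⁻¹) (x + ζ) * f x) (nhdsWithin 0 (Set.Ioi 0))
      (nhds (C ^ 2 * (Real.pi / b) ^ (n / 2 : ℂ) * ∫ x, gaussian (-(4 * b)⁻¹) (x + ζ) * f x)) := by
    refine (((tendsto_const_nhds.div hlim hb₀).cpow tendsto_const_nhds
      (ofReal_div_mem_slitPlane Real.pi_pos hb hb₀)).const_mul _).mul (tendsto_integral_gaussian_mul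
        ((hlim.const_mul 4).inv₀ (by simpa using hb₀)).neg ?_ hf ζ)
    filter_upwards [hre] with ε hε
    have h4 : 0 ≤ (4 * (b + ε)).re := by
      rw [show (4 : ℂ) = (4 : ℝ) by norm_num, Complex.re_ofReal_mul]
      positivity
    rw [Complex.neg_re, neg_nonpos, Complex.inv_re]
    exact div_nonneg h4 (Complex.normSq_nonneg _)
  refine tendsto_nhds_unique_of_eventuallyEq hleft hright ?_
  filter_upwards [hre] with ε hε
  exact fourierLaplace_gaussian_mul_fourierLaplace_of_re_pos hε hf ζ

end RealFrequencies

section Distributions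

variable {u v : TemperedDistribution (EuclideanSpace ℝ (Fin n)) ℂ}
  {f g : EuclideanSpace ℝ (Fin n) → ℂ}

theorem fourier_fourier_schwartzMap_apply (φ : 𝓢(EuclideanSpace ℝ (Fin n), ℂ))
    (x : EuclideanSpace ℝ (Fin n)) : 𝓕 (𝓕 φ) x = φ (-x) := by
  conv_rhs => rw [← FourierTransform.fourierInv_fourier_eq (F := 𝓢(EuclideanSpace ℝ (Fin n), ℂ)) φ]
  rw [SchwartzMap.fourierInv_coe, Real.fourierInv_eq_fourier_neg, neg_neg,
    ← SchwartzMap.fourier_coe]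

theorem schwartzFourier_schwartzFourier_apply (φ : 𝓢(EuclideanSpace ℝ (Fin n), ℂ))
    (x : EuclideanSpace ℝ (Fin n)) : schwartzFourier n (schwartzFourier n φ) x = φ (-x) := by
  have hdilation :
      SchwartzMap.compCLMOfContinuousLinearEquiv ℂ (dilation n).symm (schwartzFourier n φ) =
        (((2 * Real.pi) ^ (-(n : ℝ) / 2) : ℝ) : ℂ) • 𝓕 φ := by
    ext y
    change (((2 * Real.pi) ^ (-(n : ℝ) / 2) : ℝ) : ℂ) * (𝓕 φ) (dilation n ((dilation n).symm y)) = _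
    rw [ContinuousLinearEquiv.apply_symm_apply]
    rfl
  have hconst :
      (2 * Real.pi) ^ (-(n : ℝ) / 2) * (2 * Real.pi) ^ n * (2 * Real.pi) ^ (-(n : ℝ) / 2) = 1 := by
    rw [← Real.rpow_natCast, ← Real.rpow_add (by positivity), ← Real.rpow_add (by positivity)]
    ring_nf
    exact Real.rpow_zero _
  rw [schwartzFourier_eq, hdilation, FourierTransform.fourier_smul, smul_smul, smul_apply,
    fourier_fourier_schwartzMap_apply, ← Complex.ofReal_mul, hconst, Complex.ofReal_one, one_smul]

theorem fourier_fourier_fourier_fourier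
    (u : TemperedDistribution (EuclideanSpace ℝ (Fin n)) ℂ) :
    fourier (fourier (fourier (fourier u))) = u := by
  ext φ
  simp only [fourier_apply]
  congr 1
  ext x
  rw [schwartzFourier_schwartzFourier_apply, schwartzFourier_schwartzFourier_apply, neg_neg]

theorem fourier_injective :
    Function.Injective (fourier : TemperedDistribution (EuclideanSpace ℝ (Fin n)) ℂ → _) := by
  intro u v h
  rw [← fourier_fourier_fourier_fourier u, h, fourier_fourier_fourier_fourier]

theorem mulGaussian_mulGaussian {c d : ℂ} (hc : c.re ≤ 0) (hd : d.re ≤ 0)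
    (u : TemperedDistribution (EuclideanSpace ℝ (Fin n)) ℂ) :
    mulGaussian d (mulGaussian c u) = mulGaussian (c + d) u := by
  rw [mulGaussian, mulGaussian, TemperedDistribution.smulLeftCLM_smulLeftCLM_apply
    (hasTemperateGrowth_gaussian hc) (hasTemperateGrowth_gaussian hd), mulGaussian]
  congr 2
  exact funext (gaussian_mul_gaussian c d)

theorem mulGaussian_zero (u : TemperedDistribution (EuclideanSpace ℝ (Fin n)) ℂ) :
    mulGaussian 0 u = u := by
  rw [mulGaussian, funext gaussian_zero, TemperedDistribution.smulLeftCLM_const, one_smul]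

theorem IsFunction.mulGaussian (hu : IsFunction u f) {c : ℂ} (hc : c.re ≤ 0) :
    IsFunction (mulGaussian c u) fun x ↦ gaussian c x * f x := by
  intro φ
  have h := hu (SchwartzMap.smulLeftCLM ℂ (gaussian c) φ)
  simp only [SchwartzMap.smulLeftCLM_apply_apply (hasTemperateGrowth_gaussian hc), smul_eq_mul,
    mul_assoc, mul_left_comm (gaussian c _)] at h
  exact h

theorem IsFunction.const_smul (hu : IsFunction u f) (c : ℂ) :
    IsFunction (c • u) fun x ↦ c * f x := by
  intro φ
  simp only [mul_left_comm (φ _) c, integral_const_mul]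
  exact ⟨(hu φ).1.const_mul c, congrArg (c * ·) (hu φ).2⟩

theorem IsFunction.ae_eq (hf : IsFunction u f) (hg : IsFunction u g)
    (hf' : LocallyIntegrable f) (hg' : LocallyIntegrable g) : f =ᵐ[volume] g := by
  refine (ae_eq_zero_of_integral_contDiff_smul_eq_zero (hf'.sub hg') fun ψ hψ hψc ↦ ?_).mono
    fun x ↦ sub_eq_zero.1
  have hsupp : HasCompactSupport fun x ↦ (ψ x : ℂ) := hψc.comp_left Complex.ofReal_zero
  have hsmooth : ContDiff ℝ ∞ fun x ↦ (ψ x : ℂ) := Complex.ofRealCLM.contDiff.comp hψ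
  have hfψ := hf (hsupp.toSchwartzMap hsmooth)
  have hgψ := hg (hsupp.toSchwartzMap hsmooth)
  simp only [HasCompactSupport.toSchwartzMap_toFun] at hfψ hgψ
  simp only [Pi.sub_apply, Complex.real_smul, mul_sub]
  rw [integral_sub hfψ.1 hgψ.1, ← hfψ.2, ← hgψ.2, sub_self]

theorem IsFunction.unique (hu : IsFunction u f) (hv : IsFunction v f) : u = v := by
  ext φ
  rw [(hu φ).2, (hv φ).2]

theorem exists_isFunction (hf : Integrable f) :
    ∃ u : TemperedDistribution (EuclideanSpace ℝ (Fin n)) ℂ, IsFunction u f := by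
  have hf₁ : MemLp f 1 := memLp_one_iff_integrable.2 hf
  refine ⟨Lp.toTemperedDistribution (hf₁.toLp f), fun φ ↦ ⟨?_, ?_⟩⟩
  · obtain ⟨C, -, hC⟩ := φ.decay 0 0
    exact hf.bdd_mul (c := C) φ.continuous.aestronglyMeasurable
      (.of_forall fun x ↦ by simpa using hC x)
  · rw [Lp.toTemperedDistribution_apply]
    refine integral_congr_ae ?_
    filter_upwards [hf₁.coeFn_toLp] with x hx
    rw [hx, smul_eq_mul]

theorem IsFunction.fourier (hu : IsFunction u f) (hf : Integrable f) :
    IsFunction (fourier u) fun ξ ↦ fourierLaplace f (complexPoint ξ 0) := by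
  intro φ
  have hbound (ξ : EuclideanSpace ℝ (Fin n)) : ‖fourierLaplace f (complexPoint ξ 0)‖ ≤
      (2 * Real.pi) ^ (-(n : ℝ) / 2) * ∫ x, ‖f x‖ := by
    rw [fourierLaplace_eq_fourierIntegral, norm_mul, Complex.norm_real,
      Real.norm_of_nonneg (by positivity)]
    gcongr
    exact VectorFourier.norm_fourierIntegral_le_integral_norm _ _ _ _ _
  refine ⟨φ.integrable.mul_bdd (continuous_fourierLaplace_real hf).aestronglyMeasurable
    (.of_forall hbound), ?_⟩
  rw [fourier_apply, (hu _).2]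
  simp only [schwartzFourier_eq_fourierLaplace, integral_fourierLaplace_mul φ.integrable hf]

theorem gaussian_add (c : ℂ) (x y : EuclideanSpace ℝ (Fin n)) :
    gaussian c (x + y) =
      gaussian c y * (Complex.exp (2 * c * ((inner ℝ x y : ℝ) : ℂ)) * gaussian c x) := by
  rw [gaussian, gaussian, gaussian, ← Complex.exp_add, ← Complex.exp_add, norm_add_sq_real]
  push_cast
  ring_nf

/-- The free Schrödinger evolution over a fixed time, written as chirp, Fourier transform,
chirp. -/
theorem exists_schwartzFourier_chirp : ∃ C : ℂ, C ≠ 0 ∧ ∀ φ : 𝓢(EuclideanSpace ℝ (Fin n), ℂ),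
    schwartzFourier n (SchwartzMap.smulLeftCLM ℂ (gaussian (Complex.I / 2))
        (schwartzFourier n φ)) =
      C • SchwartzMap.smulLeftCLM ℂ (gaussian (-(Complex.I / 2)))
        (schwartzFourier n (SchwartzMap.smulLeftCLM ℂ (gaussian (-(Complex.I / 2))) φ)) := by
  have hb : -(Complex.I / 2) ≠ 0 := by simp
  have hinv : -(4 * -(Complex.I / 2))⁻¹ = -(Complex.I / 2) := by
    field_simp
    linear_combination 4 * Complex.I_sq
  have hC : (((2 * Real.pi) ^ (-(n : ℝ) / 2) : ℝ) : ℂ) ≠ 0 :=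
    Complex.ofReal_ne_zero.2 (by positivity)
  have hpi : (Real.pi / -(Complex.I / 2)) ^ (n / 2 : ℂ) ≠ 0 :=
    Complex.cpow_ne_zero_iff.2 (.inl (div_ne_zero (by simp [Real.pi_ne_zero]) hb))
  refine ⟨_, mul_ne_zero hC hpi, fun φ ↦ ?_⟩
  ext ζ
  have hφ : ⇑(schwartzFourier n φ) = fun ξ ↦ fourierLaplace φ (complexPoint ξ 0) :=
    funext (schwartzFourier_eq_fourierLaplace φ)
  have hchirp : ⇑(SchwartzMap.smulLeftCLM ℂ (gaussian (Complex.I / 2)) (schwartzFourier n φ)) =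
      fun ξ ↦ gaussian (Complex.I / 2) ξ * fourierLaplace φ (complexPoint ξ 0) := by
    ext ξ
    rw [SchwartzMap.smulLeftCLM_apply_apply (hasTemperateGrowth_gaussian (by simp)), hφ,
      smul_eq_mul]
  have hfresnel := fourierLaplace_gaussian_mul_fourierLaplace (b := -(Complex.I / 2)) (by simp) hb
    φ.integrable (hφ ▸ (schwartzFourier n φ).integrable) ζ
  rw [schwartzFourier_eq_fourierLaplace, hchirp, ← neg_neg (Complex.I / 2), hfresnel, neg_neg, hinv]
  simp only [smul_apply, smul_eq_mul, schwartzFourier_apply, SchwartzMap.smulLeftCLM_apply_apply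
    (hasTemperateGrowth_gaussian (c := -(Complex.I / 2)) (by simp)), gaussian_add, mul_assoc,
    integral_const_mul]
  ring_nf

theorem exists_fourier_chirp : ∃ C : ℂ, C ≠ 0 ∧
    ∀ u : TemperedDistribution (EuclideanSpace ℝ (Fin n)) ℂ,
      fourier (mulGaussian (Complex.I / 2) (fourier u)) =
        C • mulGaussian (-(Complex.I / 2)) (fourier (mulGaussian (-(Complex.I / 2)) u)) := by
  obtain ⟨C, hC, h⟩ := exists_schwartzFourier_chirp (n := n)
  refine ⟨C, hC, fun u ↦ ?_⟩
  ext φ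
  change u (schwartzFourier n (SchwartzMap.smulLeftCLM ℂ _ (schwartzFourier n φ))) = _
  rw [h, map_smul]
  rfl

end Distributions

section WeightedL2

variable {a : ℝ} {f : EuclideanSpace ℝ (Fin n) → ℂ}

theorem aestronglyMeasurable_gaussian_mul_iff {c : ℂ} :
    AEStronglyMeasurable (fun x ↦ gaussian c x * f x) ↔ AEStronglyMeasurable f := by
  refine ⟨fun h ↦ ?_, (continuous_gaussian c).aestronglyMeasurable.mul⟩
  exact ((continuous_gaussian (-c)).aestronglyMeasurable.mul h).congr
    (.of_forall fun x ↦ gaussian_neg_mul_gaussian_mul c (f x) x)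

theorem memLp_two_withDensity_exp_iff :
    MemLp f 2 (volume.withDensity fun x ↦ ENNReal.ofReal (Real.exp (a * ‖x‖ ^ 2))) ↔
      MemLp (fun x ↦ gaussian ((a / 2 : ℝ) : ℂ) x * f x) 2 := by
  have hw : Measurable fun x : EuclideanSpace ℝ (Fin n) ↦
      ENNReal.ofReal (Real.exp (a * ‖x‖ ^ 2)) := by fun_prop
  have hac : (volume : Measure (EuclideanSpace ℝ (Fin n))) ≪
      volume.withDensity fun x ↦ ENNReal.ofReal (Real.exp (a * ‖x‖ ^ 2)) :=
    withDensity_absolutelyContinuous' hw.aemeasurable (.of_forall fun x ↦ by simp [Real.exp_pos])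
  have hsq (x : EuclideanSpace ℝ (Fin n)) :
      ‖gaussian ((a / 2 : ℝ) : ℂ) x * f x‖ ^ 2 = Real.exp (a * ‖x‖ ^ 2) * ‖f x‖ ^ 2 := by
    rw [norm_mul, norm_gaussian, mul_pow, ← Real.exp_nat_mul, Complex.ofReal_re]
    push_cast
    ring_nf
  have hiff (hf : AEStronglyMeasurable f) :
      MemLp f 2 (volume.withDensity fun x ↦ ENNReal.ofReal (Real.exp (a * ‖x‖ ^ 2))) ↔
        MemLp (fun x ↦ gaussian ((a / 2 : ℝ) : ℂ) x * f x) 2 := by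
    rw [memLp_two_iff_integrable_sq_norm (hf.mono_ac (withDensity_absolutelyContinuous _ _)),
      memLp_two_iff_integrable_sq_norm (aestronglyMeasurable_gaussian_mul_iff.2 hf),
      integrable_withDensity_iff_integrable_smul' hw (by simp)]
    simp only [hsq, ENNReal.toReal_ofReal (Real.exp_nonneg _), smul_eq_mul]
  exact ⟨fun h ↦ (hiff (h.aestronglyMeasurable.mono_ac hac)).1 h, fun h ↦
    (hiff (aestronglyMeasurable_gaussian_mul_iff.1 h.aestronglyMeasurable)).2 h⟩

theorem memLp_two_gaussian {c : ℂ} (hc : c.re < 0) :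
    MemLp (gaussian c : EuclideanSpace ℝ (Fin n) → ℂ) 2 := by
  rw [memLp_two_iff_integrable_sq_norm (continuous_gaussian c).aestronglyMeasurable]
  simpa only [sq, ← norm_mul, gaussian_mul_gaussian] using
    (integrable_gaussian (n := n) (c := c + c) (by simpa using add_neg hc hc)).norm

theorem integrable_gaussian_mul_of_memLp_two (ha : 0 < a)
    (hf : MemLp (fun x ↦ gaussian ((a / 2 : ℝ) : ℂ) x * f x) 2) :
    Integrable fun x ↦ gaussian ((a / 4 : ℝ) : ℂ) x * f x := by
  refine ((memLp_two_gaussian (c := ((-(a / 4) : ℝ) : ℂ)) ?_).integrable_mul hf).congr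
    (.of_forall fun x ↦ ?_)
  · simpa using ha
  · simp only [Pi.mul_apply, ← mul_assoc, gaussian_mul_gaussian, ← Complex.ofReal_add]
    ring_nf

theorem integrable_of_gaussian_mul {c : ℂ} (hc : 0 ≤ c.re)
    (hf : Integrable fun x ↦ gaussian c x * f x) : Integrable f := by
  refine hf.mono (aestronglyMeasurable_gaussian_mul_iff.1 hf.aestronglyMeasurable)
    (.of_forall fun x ↦ ?_)
  rw [norm_mul, norm_gaussian]
  exact le_mul_of_one_le_left (norm_nonneg _)
    (Real.one_le_exp (mul_nonneg hc (sq_nonneg _)))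

end WeightedL2

section EntireExtension

variable {a a' κ : ℝ} {F : EuclideanSpace ℂ (Fin n) → ℂ}
  {u : TemperedDistribution (EuclideanSpace ℝ (Fin n)) ℂ}

/-- `u` is the restriction to `ℝⁿ` of an entire function satisfying a Gaussian bound with rate `a`.
The rate `a = 0` is what Gaussian decay of the Fourier transform gives; positive rates give
`HasGaussianExtension`. -/
def HasEntireExtension (a : ℝ) (u : TemperedDistribution (EuclideanSpace ℝ (Fin n)) ℂ) : Prop :=
  ∃ F : EuclideanSpace ℂ (Fin n) → ℂ,
    Differentiable ℂ F ∧ IsFunction u (fun x ↦ F (complexPoint x 0)) ∧ GaussianBound a F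

theorem hasGaussianExtension_iff :
    HasGaussianExtension u ↔ ∃ a > 0, HasEntireExtension a u := by
  constructor
  · rintro ⟨F, hF, hu, N, a, b, hN, ha, hb, hbound⟩
    exact ⟨a, ha, F, hF, hu, N, b, hN, hb, hbound⟩
  · rintro ⟨a, ha, F, hF, hu, N, b, hN, hb, hbound⟩
    exact ⟨F, hF, hu, N, a, b, hN, ha, hb, hbound⟩

theorem GaussianBound.exp_mul_dot_self_mul (hF : GaussianBound a F) {c : ℂ} (ha : a' < a - c.re) :
    GaussianBound a' fun z ↦ Complex.exp (c * dot z z) * F z := by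
  simpa only [sub_add_cancel] using
    (gaussianBound_exp_mul_dot_self (a := a' - a) (by linarith)).mul hF

theorem GaussianBound.memLp_two (hF : GaussianBound a F) (hFc : Continuous F) (ha : 0 < a) :
    MemLp (fun x ↦ F (complexPoint x 0)) 2 := by
  have hcont : Continuous fun x ↦ F (complexPoint x 0) := by fun_prop
  rw [memLp_two_iff_integrable_sq_norm hcont.aestronglyMeasurable]
  simpa only [← sq, norm_pow] using
    ((hF.mul hF).integrable (hFc.mul hFc) (add_pos ha ha) 0).norm

theorem HasEntireExtension.mulGaussian (h : HasEntireExtension a u) {c : ℂ} (hc : c.re ≤ 0)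
    (ha : a' < a - c.re) : HasEntireExtension a' (mulGaussian c u) := by
  obtain ⟨F, hF, hu, hbound⟩ := h
  refine ⟨fun z ↦ Complex.exp (c * dot z z) * F z, by fun_prop, ?_, hbound.exp_mul_dot_self_mul ha⟩
  simp only [exp_mul_dot_self_complexPoint_zero]
  exact hu.mulGaussian hc

theorem HasEntireExtension.const_smul (h : HasEntireExtension a u) (c : ℂ) :
    HasEntireExtension a (c • u) := by
  obtain ⟨F, hF, hu, N, b, -, hb, hbound⟩ := h
  refine ⟨fun z ↦ c * F z, hF.const_mul c, hu.const_smul c,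
    gaussianBound_of_norm_le (N := ‖c‖ * N) hb fun x y ↦ ?_⟩
  rw [norm_mul, mul_assoc]
  gcongr
  exact hbound x y

theorem HasGaussianExtension.mulGaussian (h : HasGaussianExtension u) {c : ℂ} (hc : c.re ≤ 0) :
    HasGaussianExtension (mulGaussian c u) := by
  obtain ⟨a, ha, h⟩ := hasGaussianExtension_iff.1 h
  exact hasGaussianExtension_iff.2 ⟨a / 2, half_pos ha, h.mulGaussian hc (by linarith)⟩

theorem hasGaussianExtension_mulGaussian_I_mul_iff (t : ℝ) :
    HasGaussianExtension (mulGaussian (Complex.I * t) u) ↔ HasGaussianExtension u := by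
  refine ⟨fun h ↦ ?_, fun h ↦ h.mulGaussian (by simp)⟩
  simpa only [mulGaussian_mulGaussian (c := Complex.I * t) (d := -(Complex.I * t)) (by simp)
    (by simp), add_neg_cancel, mulGaussian_zero] using
    h.mulGaussian (c := -(Complex.I * t)) (by simp)

theorem HasGaussianExtension.fourier (h : HasGaussianExtension u) :
    HasGaussianExtension (fourier u) := by
  obtain ⟨a, ha, F, hF, hu, hbound⟩ := hasGaussianExtension_iff.1 h
  obtain ⟨a', ha', hbound'⟩ := hbound.fourierLaplace hF ha
  have hFc := hF.continuous
  have hint := (hbound.exp_mul_dot_self_mul (a' := a / 4) (c := (a / 2 : ℝ))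
    (by rw [Complex.ofReal_re]; linarith)).integrable (by fun_prop) (by positivity) 0
  simp only [exp_mul_dot_self_complexPoint_zero] at hint
  exact hasGaussianExtension_iff.2 ⟨a', ha', _, differentiable_fourierLaplace (half_pos ha) hint,
    hu.fourier (hbound.integrable hFc ha 0), hbound'⟩

theorem hasGaussianExtension_fourier_iff :
    HasGaussianExtension (GaussianDecay.fourier u) ↔ HasGaussianExtension u := by
  refine ⟨fun h ↦ ?_, HasGaussianExtension.fourier⟩
  rw [← fourier_fourier_fourier_fourier u]
  exact h.fourier.fourier.fourier

theorem HasGaussianExtension.expLaplacian (h : HasGaussianExtension u) {z : ℂ} (hz : 0 ≤ z.re) :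
    HasGaussianExtension (expLaplacian z u) := by
  rw [← hasGaussianExtension_fourier_iff, fourier_expLaplacian hz]
  exact h.fourier.mulGaussian (by simpa using hz)

theorem HasGaussianExtension.exists_memGaussianL2 (h : HasGaussianExtension u) :
    ∃ a : ℝ, 0 < a ∧ MemGaussianL2 a u := by
  obtain ⟨a, ha, F, hF, hu, hbound⟩ := hasGaussianExtension_iff.1 h
  have hFc := hF.continuous
  have hmem := (hbound.exp_mul_dot_self_mul (a' := a / 4) (c := (a / 2 : ℝ))
    (by rw [Complex.ofReal_re]; linarith)).memLp_two (by fun_prop) (by positivity)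
  simp only [exp_mul_dot_self_complexPoint_zero] at hmem
  exact ⟨a, ha, _, memLp_two_withDensity_exp_iff.2 hmem, hu⟩

theorem HasGaussianExtension.hasGaussianDecay (h : HasGaussianExtension u) :
    HasGaussianDecay u := by
  obtain ⟨b₁, hb₁, h₁⟩ := h.exists_memGaussianL2
  obtain ⟨b₂, hb₂, h₂⟩ := h.fourier.exists_memGaussianL2
  exact ⟨b₁, b₂, hb₁, hb₂, h₁, h₂⟩

theorem MemGaussianL2.fourier (h : MemGaussianL2 a u) (ha : 0 < a) :
    HasEntireExtension 0 (fourier u) := by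
  obtain ⟨f, hf, hu⟩ := h
  have hint := integrable_gaussian_mul_of_memLp_two ha (memLp_two_withDensity_exp_iff.1 hf)
  have ha' : 0 < a / 4 := by positivity
  exact ⟨fourierLaplace f, differentiable_fourierLaplace ha' hint,
    hu.fourier (integrable_of_gaussian_mul (by simpa using ha'.le) hint),
    gaussianBound_zero_fourierLaplace ha' hint⟩

theorem MemGaussianL2.mulGaussian (h : MemGaussianL2 a u) {c : ℂ} (hc : c.re ≤ 0) :
    MemGaussianL2 a (mulGaussian c u) := by
  obtain ⟨f, hf, hu⟩ := h
  refine ⟨_, hf.of_le ((continuous_gaussian c).aestronglyMeasurable.mul hf.aestronglyMeasurable)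
    (.of_forall fun x ↦ ?_), hu.mulGaussian hc⟩
  rw [Pi.mul_apply, norm_mul]
  exact mul_le_of_le_one_left (norm_nonneg _) (norm_gaussian_le_one hc x)

theorem hasGaussianExtension_of_chirp (hκ : κ ≠ 0) (h₁ : HasEntireExtension 0 u)
    (h₂ : HasEntireExtension 0 (mulGaussian (Complex.I * κ) u)) : HasGaussianExtension u := by
  obtain ⟨F, hF, huF, hFbound⟩ := h₁
  obtain ⟨G, hG, huG, hGbound⟩ := h₂
  have hchirp : Differentiable ℂ fun z ↦ Complex.exp (Complex.I * κ * dot z z) * F z := by fun_prop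
  have hGF : G = fun z ↦ Complex.exp (Complex.I * κ * dot z z) * F z := by
    have huF' := huF.mulGaussian (c := Complex.I * κ) (by simp)
    simp only [← exp_mul_dot_self_complexPoint_zero] at huF'
    have hae := huG.ae_eq huF' (continuous_restrict hG).locallyIntegrable
      (continuous_restrict hchirp).locallyIntegrable
    exact eq_of_eqOn_real hG hchirp (congrFun ((continuous_restrict hG).ae_eq_iff_eq volume
      (continuous_restrict hchirp) |>.1 hae))
  obtain ⟨a, ha, hbound⟩ := hFbound.exists_pos_of_chirp hκ hF (hGF ▸ hGbound)
  exact hasGaussianExtension_iff.2 ⟨a, ha, F, hF, huF, hbound⟩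

end EntireExtension

section Equivalences

variable {u : TemperedDistribution (EuclideanSpace ℝ (Fin n)) ℂ}

theorem hasGaussianExtension_of_memGaussianL2_schrodinger {t₁ t₂ a₁ a₂ : ℝ} (ht : t₁ ≠ t₂)
    (ha₁ : 0 < a₁) (ha₂ : 0 < a₂) (h₁ : MemGaussianL2 a₁ (expLaplacian (Complex.I * t₁) u))
    (h₂ : MemGaussianL2 a₂ (expLaplacian (Complex.I * t₂) u)) : HasGaussianExtension u := by
  have hfourier (t : ℝ) : fourier (expLaplacian (Complex.I * t) u) =
      mulGaussian (Complex.I * (-t : ℝ)) (fourier u) := by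
    rw [fourier_expLaplacian (by simp), Complex.ofReal_neg, mul_neg]
  have hshift : mulGaussian (Complex.I * (-t₂ : ℝ)) (fourier u) =
      mulGaussian (Complex.I * (t₁ - t₂ : ℝ))
        (mulGaussian (Complex.I * (-t₁ : ℝ)) (fourier u)) := by
    rw [mulGaussian_mulGaussian (by simp) (by simp)]
    push_cast
    ring_nf
  have h₁' := h₁.fourier ha₁
  have h₂' := h₂.fourier ha₂
  rw [hfourier] at h₁' h₂'
  rw [← hasGaussianExtension_fourier_iff, ← hasGaussianExtension_mulGaussian_I_mul_iff (-t₁)]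
  exact hasGaussianExtension_of_chirp (sub_ne_zero.2 ht) h₁' (hshift ▸ h₂')

theorem HasGaussianDecay.hasGaussianExtension (h : HasGaussianDecay u) :
    HasGaussianExtension u := by
  obtain ⟨b₁, b₂, hb₁, hb₂, h₁, h₂⟩ := h
  obtain ⟨C, hC, hchirp⟩ := exists_fourier_chirp (n := n)
  have hneg : -(Complex.I / 2) = Complex.I * (-(1 / 2) : ℝ) := by push_cast; ring
  have h₁' := (h₁.mulGaussian (c := -(Complex.I / 2)) (by simp)).fourier hb₁
  have h₂' := (h₂.mulGaussian (c := Complex.I / 2) (by simp)).fourier hb₂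
  rw [hchirp] at h₂'
  have h₂'' := h₂'.const_smul C⁻¹
  rw [inv_smul_smul₀ hC] at h₂''
  rw [hneg] at h₁' h₂''
  rw [← hasGaussianExtension_mulGaussian_I_mul_iff (-(1 / 2)), ← hasGaussianExtension_fourier_iff]
  exact hasGaussianExtension_of_chirp (by norm_num) h₁' h₂''

theorem hasGaussianDecay_iff_hasGaussianExtension : HasGaussianDecay u ↔ HasGaussianExtension u :=
  ⟨HasGaussianDecay.hasGaussianExtension, HasGaussianExtension.hasGaussianDecay⟩

theorem MemGaussianL2.hasGaussianExtension_heat {δ ε : ℝ} (h : MemGaussianL2 ε u) (hδ : 0 < δ)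
    (hε : 0 < ε) : HasGaussianExtension (expLaplacian (δ : ℂ) u) := by
  rw [← hasGaussianExtension_fourier_iff, fourier_expLaplacian (by simpa using hδ.le)]
  exact hasGaussianExtension_iff.2 ⟨δ / 2, half_pos hδ,
    (h.fourier hε).mulGaussian (by simpa using hδ.le) (by simpa using hδ)⟩

theorem HasEntireExtension.exists_mulGaussian_eq {a δ : ℝ} (h : HasEntireExtension a u)
    (hδ : 0 ≤ δ) (ha : δ < a) :
    ∃ v, HasGaussianExtension v ∧ GaussianDecay.mulGaussian (-(δ : ℂ)) v = u := by
  obtain ⟨F, hF, hu, hbound⟩ := h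
  have hpos : 0 < (a - δ) / 2 := by linarith
  have hbound' := hbound.exp_mul_dot_self_mul (a' := (a - δ) / 2) (c := δ)
    (by rw [Complex.ofReal_re]; linarith)
  have hdiff : Differentiable ℂ fun z ↦ Complex.exp (δ * dot z z) * F z := by fun_prop
  obtain ⟨v, hv⟩ := exists_isFunction (hbound'.integrable hdiff.continuous hpos 0)
  refine ⟨v, hasGaussianExtension_iff.2 ⟨_, hpos, _, hdiff, hv, hbound'⟩, ?_⟩
  have hv' := hv.mulGaussian (c := -(δ : ℂ)) (by simpa using hδ)
  simp only [exp_mul_dot_self_complexPoint_zero, gaussian_neg_mul_gaussian_mul] at hv'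
  exact hv'.unique hu

theorem HasGaussianExtension.exists_eq_expLaplacian (h : HasGaussianExtension u) :
    ∃ δ ε : ℝ, 0 < δ ∧ 0 < ε ∧ ∃ v : TemperedDistribution (EuclideanSpace ℝ (Fin n)) ℂ,
      MemGaussianL2 ε v ∧ u = GaussianDecay.expLaplacian (δ : ℂ) v := by
  obtain ⟨a, ha, (hfourier : HasEntireExtension a _)⟩ := hasGaussianExtension_iff.1 h.fourier
  obtain ⟨v, hv, hvu⟩ := hfourier.exists_mulGaussian_eq (half_pos ha).le (half_lt_self ha)
  obtain ⟨ε, hε, hmem⟩ := hv.fourier.fourier.fourier.exists_memGaussianL2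
  refine ⟨a / 2, ε, half_pos ha, hε, _, hmem, fourier_injective ?_⟩
  rw [fourier_expLaplacian (by simpa using (half_pos ha).le), fourier_fourier_fourier_fourier, hvu]

end Equivalences

end GaussianDecay

end

theorem theorem1p1 (n : ℕ) (u₀ : TemperedDistribution (EuclideanSpace ℝ (Fin n)) ℂ) (τ : ℝ) :
    List.TFAE [
      (∃ t₁ t₂ : ℝ, t₁ ≠ t₂ ∧ ∃ a₁ a₂ : ℝ, 0 < a₁ ∧ 0 < a₂ ∧
        GaussianDecay.MemGaussianL2 a₁ (GaussianDecay.expLaplacian (Complex.I * t₁) u₀) ∧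
        GaussianDecay.MemGaussianL2 a₂ (GaussianDecay.expLaplacian (Complex.I * t₂) u₀)),
      GaussianDecay.HasGaussianDecay u₀,
      (∃ ν : ℝ≥0 → ℝ, (∀ t, 0 < ν t) ∧ ∀ t : ℝ≥0,
        GaussianDecay.MemGaussianL2 (ν t)
          (GaussianDecay.expLaplacian (Complex.I * ((t : ℝ) : ℂ)) u₀)),
      GaussianDecay.HasGaussianDecay (GaussianDecay.mulGaussian (Complex.I * τ) u₀),
      GaussianDecay.HasGaussianExtension u₀,
      GaussianDecay.HasGaussianExtension (GaussianDecay.fourier u₀),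
      (∃ δ ε : ℝ, 0 < δ ∧ 0 < ε ∧
        ∃ h : TemperedDistribution (EuclideanSpace ℝ (Fin n)) ℂ,
          GaussianDecay.MemGaussianL2 ε h ∧ u₀ = GaussianDecay.expLaplacian (δ : ℂ) h)] := by
  have hre (t : ℝ) : 0 ≤ (Complex.I * t).re := by simp
  tfae_have 1 → 5 := fun ⟨_, _, ht, _, _, ha₁, ha₂, h₁, h₂⟩ ↦
    GaussianDecay.hasGaussianExtension_of_memGaussianL2_schrodinger ht ha₁ ha₂ h₁ h₂
  tfae_have 2 ↔ 5 := GaussianDecay.hasGaussianDecay_iff_hasGaussianExtension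
  tfae_have 5 → 3 := by
    intro h
    choose ν hν hmem using fun t : ℝ≥0 ↦ (h.expLaplacian (hre t)).exists_memGaussianL2
    exact ⟨ν, hν, hmem⟩
  tfae_have 3 → 1 := fun ⟨ν, hν, hmem⟩ ↦
    ⟨((0 : ℝ≥0) : ℝ), ((1 : ℝ≥0) : ℝ), by simp, ν 0, ν 1, hν 0, hν 1, hmem 0, hmem 1⟩
  tfae_have 4 ↔ 5 := GaussianDecay.hasGaussianDecay_iff_hasGaussianExtension.trans
    (GaussianDecay.hasGaussianExtension_mulGaussian_I_mul_iff τ)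
  tfae_have 6 ↔ 5 := GaussianDecay.hasGaussianExtension_fourier_iff
  tfae_have 5 → 7 := GaussianDecay.HasGaussianExtension.exists_eq_expLaplacian
  tfae_have 7 → 5 := by
    rintro ⟨δ, ε, hδ, hε, v, hmem, rfl⟩
    exact hmem.hasGaussianExtension_heat hδ hε
  tfae_finish
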